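/- Let $X\subseteq\mathbb R^n$ be compact and convex, let $\Xi\subseteq\mathbb R^\nu$ be bounded, and let $\mathcal P(\Xi)$ be the set of probability distributions on $\Xi$. Let $\theta:\mathbb R^n\to\mathbb R$, $h:\mathbb R^l\to\mathbb R$, $f:\mathbb R^n\times\mathbb R^m\times\Xi\to\mathbb R^l$, $M:\Xi\to\mathbb R^{m\times m}$ and $q:\mathbb R^n\times\Xi\to\mathbb R^m$ be Lipschitz continuous, with $\theta$, $h$ and $f(\cdot,\cdot,\xi)$ continuously differentiable and each $M(\xi)$ positive semidefinite (not necessarily symmetric). Let $\Psi$ be a Lipschitz continuous mapping from $\Xi$ to a finite dimensional normed space $V$ and $\Gamma\subseteq V$ a closed convex cone, and put $\mathcal P=\{P\in\mathcal P(\Xi):\mathbb E_P[\Psi(\xi)]\in\Gamma\}$. Assume that there are $P_0\in\mathcal P(\Xi)$ and $\alpha>0$ with $\mathbb E_{P_0}[\Psi(\xi)]+\alpha\mathbb B\subseteq\Gamma$, where $\mathbb B$ is the closed unit ball of $V$. Let $\mathrm{SOL}(A,b)$ be the set of all $y$ with $0\le y\perp Ay+b\ge 0$. Let $\mathcal D$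 be the set of all $(x,y)$ with $x\in X$ and $y:\Xi\to\mathbb R^m$ measurable such that $y(\xi)\in\mathrm{SOL}(M(\xi),q(x,\xi))$ for all $\xi\in\Xi$. Assume that $\mathrm{SOL}(M(\xi),q(x,\xi))\ne\emptyset$ for all $x\in X$, $\xi\in\Xi$, and that $f(x,y(\xi),\xi)$ is $P$-integrable for all $(x,y)\in\mathcal D$ and $P\in\mathcal P$. The problem (P) is to minimize $\Phi(x,y)=\theta(x)+\sup_{P\in\mathcal P}h(\mathbb E_P[f(x,y(\xi),\xi)])$ over $\mathcal D$; let $v^*$ be its optimal value (an infimum in the extended reals) and $X^*$ the set of the $x$-components of its minimizers. For $\epsilon>0$ let $\hat y_\epsilon(x,\xi)$ be the unique element of $\mathrm{SOL}(M(\xi)+\epsilon I,q(x,\xi))$, and let $\bar y(x,\xi)$ be the element of least Euclidean norm of $\mathrm{SOL}(M(\xi),q(x,\xi))$. For each $k$ let $\Xi^k=\{\xi^{1},\dots,\xi^{k}\}\subseteq\Xi$ be a set of $k$ samples (which may depend on $k$), with $\beta_k=\sup_{\xi\in\Xi}\min_{1\le i\le k}\|\xi-\xi^{i}\|\to0$ as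 $k\to\infty$. Let $\mathcal P_k=\{p\in\mathbb R^k_+:\sum_ip_i=1,\ \sum_ip_i\Psi(\xi^{i})\in\Gamma\}$, and let $v^*_{\epsilon,k}$ and $X^*_{\epsilon,k}$ be the optimal value and the set of minimizers of the problem (P$_{\epsilon,k}$) $$\min_{x\in X}\ \theta(x)+\sup_{p\in\mathcal P_k}h\Big(\sum_{i=1}^kp_i\,f\big(x,\hat y_\epsilon(x,\xi^{i}),\xi^{i}\big)\Big).$$ Let $r_\epsilon>0$ for $\epsilon>0$, with $r_\epsilon\to0$ as $\epsilon\downarrow0$. Let $\vartheta_\epsilon$ be the infimum of $\Phi(x,y)$ over all $x\in X$ and all measurable $y:\Xi\to\mathbb R^m$ with $\sup_{P\in\mathcal P}\mathbb E_P[\|\hat y_\epsilon(x,\xi)-y(\xi)\|^2]\le r_\epsilon$, and assume $\vartheta_\epsilon\to v^*$ as $\epsilon\downarrow0$. Then for every $\epsilon>0$ the limit $\lim_{k\to\infty}v^*_{\epsilon,k}$ exists, and $$\lim_{\epsilon\downarrow0}\lim_{k\to\infty}v^*_{\epsilon,k}=v^*.$$ If, moreover, $\sup_{x\in X}\sup_{P\in\mathcal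 P}\mathbb E_P[\|\hat y_\epsilon(x,\xi)-\bar y(x,\xi)\|^2]\to0$ as $\epsilon\downarrow0$ and $v^*=\inf_{x\in X}\Phi(x,\bar y(x,\cdot))$, then, with $\mathrm d(A,B)=\sup_{x\in A}\inf_{z\in B}\|x-z\|$, $$\lim_{\epsilon\downarrow0}\ \limsup_{k\to\infty}\ \mathrm d(X^*_{\epsilon,k},X^*)=0.$$ -/

import Mathlib

open Filter Topology MeasureTheory

noncomputable section

/-- Euclidean space `ℝⁿ`. -/
abbrev Vec (n : ℕ) : Type := EuclideanSpace ℝ (Fin n)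

/-- `SOL(A, b)`: the solutions `y` of the linear complementarity problem
`0 ≤ y ⊥ A y + b ≥ 0`. -/
def lcpSol {m : ℕ} (A : Matrix (Fin m) (Fin m) ℝ) (b : Vec m) : Set (Vec m) :=
  {y | (∀ i, 0 ≤ y i) ∧ (∀ i, 0 ≤ A.mulVec y.ofLp i + b i) ∧
    ∑ i, y i * (A.mulVec y.ofLp i + b i) = 0}

/-- The deviation `sup_{x ∈ A} inf_{z ∈ B} ‖x - z‖`, as an extended nonnegative number. -/
def deviation {n : ℕ} (A B : Set (Vec n)) : ENNReal :=
  ⨆ x ∈ A, Metric.infEDist x B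

/-- The data of a distributionally robust mathematical program with stochastic complementarity
constraints. Mappings of the random parameter are defined on the support set `Ξ ⊆ ℝ^ν`; the values
of the moment mapping `Ψ` lie in a finite dimensional space `V`. -/
structure DRMPSCC (n m l ν : ℕ) (V : Type*) [NormedAddCommGroup V] [NormedSpace ℝ V] where
  /-- first-stage feasible set -/
  X : Set (Vec n)
  /-- support set -/
  Ξ : Set (Vec ν)
  θ : Vec n → ℝ
  h : Vec l → ℝ
  f : Vec n → Vec m → Ξ → Vec l
  M : Ξ → Matrix (Fin m) (Fin m) ℝ
  q : Vec n → Ξ → Vec m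
  /-- moment mapping -/
  Ψ : Ξ → V
  /-- cone of admissible moments -/
  Γ : ConvexCone ℝ V

namespace DRMPSCC

variable {n m l ν : ℕ} {V : Type*} [NormedAddCommGroup V] [NormedSpace ℝ V]

/-- The ambiguity set `𝒫` of all probability distributions `P` on `Ξ` with `E_P[Ψ] ∈ Γ`. -/
def ambiguity (D : DRMPSCC n m l ν V) : Set (ProbabilityMeasure D.Ξ) :=
  {P | Integrable D.Ψ (P : Measure D.Ξ) ∧ ∫ ξ, D.Ψ ξ ∂(P : Measure D.Ξ) ∈ D.Γ}

/-- The discrete ambiguity set on the samples `s 0, …, s (k-1)`: weights `p ≥ 0` with total mass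
one and `∑ i, p i • Ψ (s i) ∈ Γ`. -/
def ambiguityDisc (D : DRMPSCC n m l ν V) {k : ℕ} (s : Fin k → D.Ξ) : Set (Fin k → ℝ) :=
  {p | (∀ i, 0 ≤ p i) ∧ ∑ i, p i = 1 ∧ ∑ i, p i • D.Ψ (s i) ∈ D.Γ}

/-- The objective `Φ(x, y) = θ(x) + sup_{P ∈ 𝒫} h(E_P[f(x, y(ξ), ξ)])`, extended-real valued. -/
def Φ (D : DRMPSCC n m l ν V) (x : Vec n) (y : D.Ξ → Vec m) : EReal :=
  (D.θ x : EReal) + ⨆ P ∈ D.ambiguity, (D.h (∫ ξ, D.f x (y ξ) ξ ∂(P : Measure D.Ξ)) : EReal)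

/-- The discretized objective `θ(x) + sup_{p ∈ 𝒫_k} h(∑ i, p i • f(x, Y i, s i))`. -/
def ΦDisc (D : DRMPSCC n m l ν V) {k : ℕ} (s : Fin k → D.Ξ) (x : Vec n) (Y : Fin k → Vec m) :
    EReal :=
  (D.θ x : EReal) + ⨆ p ∈ D.ambiguityDisc s, (D.h (∑ i, p i • D.f x (Y i) (s i)) : EReal)

/-- The feasible set `𝒟`: pairs `(x, y)` with `x ∈ X` and `y` a measurable selection of the
solution sets of the complementarity problems. -/
def feasible (D : DRMPSCC n m l ν V) : Set (Vec n × (D.Ξ → Vec m)) :=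
  {z | z.1 ∈ D.X ∧ Measurable z.2 ∧ ∀ ξ, z.2 ξ ∈ lcpSol (D.M ξ) (D.q z.1 ξ)}

/-- The optimal value `v*` of the original problem. -/
def optVal (D : DRMPSCC n m l ν V) : EReal :=
  ⨅ z ∈ D.feasible, D.Φ z.1 z.2

/-- `X*`: the projection onto the `x`-space of the set of minimizers of the original problem. -/
def solX (D : DRMPSCC n m l ν V) : Set (Vec n) :=
  Prod.fst '' {z | z ∈ D.feasible ∧ ∀ z' ∈ D.feasible, D.Φ z.1 z.2 ≤ D.Φ z'.1 z'.2}

/-- `ŷ_ε(x, ξ)`: the solution of `LCP(M(ξ) + ε I, q(x, ξ))`, which is unique for `ε > 0` when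
`M(ξ)` is positive semidefinite. -/
def yReg (D : DRMPSCC n m l ν V) (ε : ℝ) (x : Vec n) (ξ : D.Ξ) : Vec m :=
  Classical.epsilon fun y => y ∈ lcpSol (D.M ξ + ε • (1 : Matrix (Fin m) (Fin m) ℝ)) (D.q x ξ)

/-- `ȳ(x, ξ)`: the least norm solution of `LCP(M(ξ), q(x, ξ))`. -/
def yLeast (D : DRMPSCC n m l ν V) (x : Vec n) (ξ : D.Ξ) : Vec m :=
  Classical.epsilon fun y => y ∈ lcpSol (D.M ξ) (D.q x ξ) ∧
    ∀ z ∈ lcpSol (D.M ξ) (D.q x ξ), ‖y‖ ≤ ‖z‖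

/-- The objective of the regularized discretized problem, reduced to the variable `x`. -/
def ΦRegDisc (D : DRMPSCC n m l ν V) {k : ℕ} (s : Fin k → D.Ξ) (ε : ℝ) (x : Vec n) : EReal :=
  D.ΦDisc s x fun i => D.yReg ε x (s i)

/-- The optimal value `v*_{ε,k}` of the regularized discretized problem. -/
def optValRegDisc (D : DRMPSCC n m l ν V) {k : ℕ} (s : Fin k → D.Ξ) (ε : ℝ) : EReal :=
  ⨅ x ∈ D.X, D.ΦRegDisc s ε x

/-- The set `X*_{ε,k}` of minimizers of the regularized discretized problem. -/
def solXRegDisc (D : DRMPSCC n m l ν V) {k : ℕ} (s : Fin k → D.Ξ) (ε : ℝ) : Set (Vec n) :=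
  {x | x ∈ D.X ∧ ∀ x' ∈ D.X, D.ΦRegDisc s ε x ≤ D.ΦRegDisc s ε x'}

/-- `ℳ_ε(x)` with radius `r`: the measurable `y` with
`sup_{P ∈ 𝒫} E_P[‖ŷ_ε(x, ξ) - y(ξ)‖²] ≤ r`. -/
def nearReg (D : DRMPSCC n m l ν V) (ε r : ℝ) (x : Vec n) : Set (D.Ξ → Vec m) :=
  {y | Measurable y ∧
    ⨆ P ∈ D.ambiguity, ∫⁻ ξ, ‖D.yReg ε x ξ - y ξ‖ₑ ^ 2 ∂(P : Measure D.Ξ) ≤ ENNReal.ofReal r}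

/-- The optimal value `ϑ_ε` of the auxiliary problem
`min Φ(x, y)` subject to `x ∈ X`, `y ∈ ℳ_ε(x)`. -/
def auxVal (D : DRMPSCC n m l ν V) (ε r : ℝ) : EReal :=
  ⨅ x ∈ D.X, ⨅ y ∈ D.nearReg ε r x, D.Φ x y

/-- The fill distance `β_k = sup_{ξ ∈ Ξ} min_i ‖ξ - s i‖` of a sample set. -/
def fillDist (D : DRMPSCC n m l ν V) {k : ℕ} (s : Fin k → D.Ξ) : ENNReal :=
  ⨆ ξ : D.Ξ, ⨅ i : Fin k, edist ξ (s i)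

/-- The standing assumptions on the data. -/
structure Standing (D : DRMPSCC n m l ν V) : Prop where
  compact_X : IsCompact D.X
  convex_X : Convex ℝ D.X
  closed_Γ : IsClosed (D.Γ : Set V)
  smooth_θ : ContDiff ℝ 1 D.θ
  smooth_h : ContDiff ℝ 1 D.h
  smooth_f : ∀ ξ, ContDiff ℝ 1 fun p : Vec n × Vec m => D.f p.1 p.2 ξ
  lip_θ : ∃ K, LipschitzWith K D.θ
  lip_h : ∃ K, LipschitzWith K D.h
  lip_M : ∃ K, LipschitzWith K fun ξ => Matrix.toEuclideanCLM (𝕜 := ℝ) (D.M ξ)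
  lip_q : ∃ K, LipschitzWith K fun p : Vec n × D.Ξ => D.q p.1 p.2
  /-- `M(ξ)` is positive semidefinite, not necessarily symmetric. -/
  psd_M : ∀ ξ, ∀ u : Fin m → ℝ, 0 ≤ u ⬝ᵥ (D.M ξ).mulVec u
  /-- relatively complete recourse -/
  recourse : ∀ x ∈ D.X, ∀ ξ, (lcpSol (D.M ξ) (D.q x ξ)).Nonempty
  /-- the expectations in the problem are well defined -/
  integrable_f : ∀ z ∈ D.feasible, ∀ P ∈ D.ambiguity,
    Integrable (fun ξ => D.f z.1 (z.2 ξ) ξ) (P : Measure D.Ξ)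

/-- The Slater type condition: `E_{P₀}[Ψ] + α 𝔹 ⊆ Γ` for some distribution `P₀` on `Ξ` and some
`α > 0`. -/
def Slater (D : DRMPSCC n m l ν V) : Prop :=
  ∃ P₀ : ProbabilityMeasure D.Ξ, ∃ α : ℝ, 0 < α ∧ Integrable D.Ψ (P₀ : Measure D.Ξ) ∧
    ∀ w : V, ‖w‖ ≤ α → ∫ ξ, D.Ψ ξ ∂(P₀ : Measure D.Ξ) + w ∈ D.Γ

end DRMPSCC

end

/-! Let `φ_ε(x) = Φ(x, ŷ_ε(x, ·))` and `w_ε = inf_X φ_ε`. The value `w_ε` is the limit in `k`, and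
the proof separates discretization at fixed `ε` from the passage `ε ↓ 0`.

Fixed `ε`: `ŷ_ε` is bounded and Lipschitz on `X × Ξ`, because `M + ε I` is strongly monotone. A
discrete distribution belongs to `𝒫`, so the discretized objective is at most `φ_ε` (`ΦRegDisc_le`).
Conversely, `P ∈ 𝒫` is pushed onto nearby samples and mixed with a little of the Slater distribution
`P₀`, which absorbs the moment error (`exists_ambiguityDisc_near`). The resulting error is uniform
in `x` (`eventually_le_ΦRegDisc_add`), hence `v*_{ε,k} → w_ε`.

Passage `ε ↓ 0`: replacing `ŷ_ε` by `y` at `L²` distance at most `η` under every `P ∈ 𝒫` changes `Φ`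
by at most `C η`, with `C` independent of `ε` (`exists_Φ_near_yReg`). Thus `ϑ_ε ≤ w_ε ≤ ϑ_ε + C
√r_ε`, and `w_ε → v*`.

Minimizers: under the uniform `L²` hypothesis, `φ_ε → φ = Φ(·, ȳ)` uniformly on `X`, so `φ` is
continuous. Minimizers of the discretized problems are near-minimizers of `φ` on the compact set
`X`, hence close to its argmin. That argmin lies in `X*` because least-norm selections attain the
value `v*`. -/

section LCP

/-! ### Monotone linear complementarity problems and Tikhonov regularization -/

variable {m : ℕ}

lemma mem_lcpSol_iff {A : Matrix (Fin m) (Fin m) ℝ} {b y : Vec m} :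
    y ∈ lcpSol A b ↔ (∀ i, 0 ≤ y i) ∧
      (∀ i, 0 ≤ (Matrix.toEuclideanCLM (𝕜 := ℝ) A y + b) i) ∧
      inner ℝ y (Matrix.toEuclideanCLM (𝕜 := ℝ) A y + b) = 0 := by
  have h : inner ℝ y (Matrix.toEuclideanCLM (𝕜 := ℝ) A y + b)
      = ∑ i, y i * (A.mulVec y.ofLp i + b i) := by
    simp [PiLp.inner_apply, mul_comm]
  rw [h]
  simp [lcpSol]

lemma inner_nonneg_of_coord {u w : Vec m} (hu : ∀ i, 0 ≤ u i) (hw : ∀ i, 0 ≤ w i) :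
    0 ≤ inner ℝ u w := by
  rw [PiLp.inner_apply]
  exact Finset.sum_nonneg fun i _ => by simpa using mul_nonneg (hw i) (hu i)

lemma inner_toEuclideanCLM_nonneg {A : Matrix (Fin m) (Fin m) ℝ}
    (hA : ∀ u : Fin m → ℝ, 0 ≤ u ⬝ᵥ A.mulVec u) (u : Vec m) :
    0 ≤ inner ℝ u (Matrix.toEuclideanCLM (𝕜 := ℝ) A u) := by
  have := hA u.ofLp
  simpa [PiLp.inner_apply, dotProduct, mul_comm] using this

lemma toEuclideanCLM_add_smul_one (A : Matrix (Fin m) (Fin m) ℝ) (ε : ℝ) (u : Vec m) :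
    Matrix.toEuclideanCLM (𝕜 := ℝ) (A + ε • (1 : Matrix (Fin m) (Fin m) ℝ)) u
      = Matrix.toEuclideanCLM (𝕜 := ℝ) A u + ε • u := by
  simp [map_add, map_smul, map_one]

/-- Monotonicity of the graph of the complementarity conditions. -/
lemma inner_sub_sub_nonpos_of_mem_lcpSol {A B : Matrix (Fin m) (Fin m) ℝ} {a b y z : Vec m}
    (hy : y ∈ lcpSol A a) (hz : z ∈ lcpSol B b) :
    inner ℝ (y - z) ((Matrix.toEuclideanCLM (𝕜 := ℝ) A y + a)
      - (Matrix.toEuclideanCLM (𝕜 := ℝ) B z + b)) ≤ 0 := by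
  rw [mem_lcpSol_iff] at hy hz
  have h1 := inner_nonneg_of_coord hy.1 hz.2.1
  have h2 := inner_nonneg_of_coord hz.1 hy.2.1
  rw [inner_sub_left, inner_sub_right, inner_sub_right, hy.2.2, hz.2.2]
  linarith

/-- The componentwise positive part. -/
noncomputable def posPartVec (u : Vec m) : Vec m := WithLp.toLp 2 fun i => max (u i) 0

lemma norm_posPartVec_sub_le (u w : Vec m) :
    ‖posPartVec u - posPartVec w‖ ≤ ‖u - w‖ := by
  rw [EuclideanSpace.norm_eq, EuclideanSpace.norm_eq]
  refine Real.sqrt_le_sqrt (Finset.sum_le_sum fun i _ => ?_)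
  have : |max (u i) 0 - max (w i) 0| ≤ |u i - w i| := abs_max_sub_max_le_abs _ _ _
  simpa [posPartVec] using sq_le_sq.2 this

/-- A small gradient step for a strongly monotone operator is a contraction. -/
lemma exists_step_contraction {E : Type*} [NormedAddCommGroup E] [InnerProductSpace ℝ E]
    (T : E →L[ℝ] E) {ε : ℝ} (hε : 0 < ε) (hT : ∀ u, ε * ‖u‖ ^ 2 ≤ inner ℝ u (T u)) :
    ∃ τ ρ : ℝ, 0 < τ ∧ 0 ≤ ρ ∧ ρ < 1 ∧ ∀ d, ‖d - τ • T d‖ ≤ Real.sqrt ρ * ‖d‖ := by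
  set C : ℝ := ‖T‖ + ε with hC
  have hCpos : 0 < C := by positivity
  -- This minimizes the bound `1 - 2 τ ε + τ² C²` on the squared contraction factor; its value there
  -- is `ρ = 1 - τ ε`.
  set τ : ℝ := ε / C ^ 2 with hτ
  have hτpos : 0 < τ := by positivity
  have hτC : τ * C ^ 2 = ε := by rw [hτ]; field_simp
  have hεC : ε ≤ C := by have := norm_nonneg T; linarith
  set ρ : ℝ := 1 - τ * ε with hρ
  have hρ0 : 0 ≤ ρ := by
    have : τ * ε ≤ 1 := by
      rw [hτ, div_mul_eq_mul_div, div_le_one (by positivity)]; nlinarith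
    linarith
  have hρ1 : ρ < 1 := by have := mul_pos hτpos hε; linarith
  refine ⟨τ, ρ, hτpos, hρ0, hρ1, fun d => ?_⟩
  refine abs_le_of_sq_le_sq' ?_ (by positivity) |>.2
  rw [mul_pow, Real.sq_sqrt hρ0, norm_sub_sq_real, inner_smul_right, norm_smul, mul_pow,
    Real.norm_eq_abs, sq_abs]
  have h1 := hT d
  have h2 : ‖T d‖ ^ 2 ≤ C ^ 2 * ‖d‖ ^ 2 := by
    rw [← mul_pow]
    refine pow_le_pow_left₀ (norm_nonneg _) ((T.le_opNorm d).trans ?_) 2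
    gcongr; linarith
  have h3 : τ ^ 2 * ‖T d‖ ^ 2 ≤ τ * ε * ‖d‖ ^ 2 := by
    calc τ ^ 2 * ‖T d‖ ^ 2 ≤ τ ^ 2 * (C ^ 2 * ‖d‖ ^ 2) := by gcongr
      _ = τ * (τ * C ^ 2) * ‖d‖ ^ 2 := by ring
      _ = _ := by rw [hτC]
  have h4 := mul_le_mul_of_nonneg_left h1 hτpos.le
  rw [hρ]
  nlinarith

/-- A strongly monotone linear complementarity problem has a solution. -/
lemma lcpSol_nonempty_of_strongly_monotone {A : Matrix (Fin m) (Fin m) ℝ} {ε : ℝ} (hε : 0 < ε)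
    (hA : ∀ u : Vec m, ε * ‖u‖ ^ 2 ≤ inner ℝ u (Matrix.toEuclideanCLM (𝕜 := ℝ) A u))
    (b : Vec m) : (lcpSol A b).Nonempty := by
  suffices h : ∃ y : Vec m, (∀ i, 0 ≤ y i) ∧
      (∀ i, 0 ≤ (Matrix.toEuclideanCLM (𝕜 := ℝ) A y + b) i) ∧
      inner ℝ y (Matrix.toEuclideanCLM (𝕜 := ℝ) A y + b) = 0 by
    obtain ⟨y, hy⟩ := h
    exact ⟨y, mem_lcpSol_iff.2 hy⟩
  generalize Matrix.toEuclideanCLM (𝕜 := ℝ) A = T at hA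
  obtain ⟨τ, ρ, hτpos, hρ0, hρ1, key⟩ := exists_step_contraction T hε hA
  -- Fixed points of this projected step are the solutions: in each coordinate either `y i = 0` or
  -- the residual vanishes.
  let g : Vec m → Vec m := fun y => posPartVec (y - τ • (T y + b))
  have hg : ContractingWith (Real.toNNReal (Real.sqrt ρ)) g := by
    refine ⟨?_, LipschitzWith.of_dist_le_mul fun y z => ?_⟩
    · rw [Real.toNNReal_lt_one]
      exact (Real.sqrt_lt' one_pos).2 (by simpa using hρ1)
    · rw [dist_eq_norm, dist_eq_norm, Real.coe_toNNReal _ (Real.sqrt_nonneg _)]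
      refine (norm_posPartVec_sub_le _ _).trans ?_
      have : y - τ • (T y + b) - (z - τ • (T z + b)) = (y - z) - τ • T (y - z) := by
        rw [map_sub]; module
      rw [this]
      exact key _
  have hfix := hg.fixedPoint_isFixedPt
  set y := ContractingWith.fixedPoint g hg
  have hi : ∀ i, max (y i - τ * (T y + b) i) 0 = y i := fun i => by
    have := congrArg (fun v : Vec m => v i) hfix.eq
    simpa only [g, posPartVec, PiLp.sub_apply, PiLp.smul_apply, smul_eq_mul] using this
  have hy0 : ∀ i, 0 ≤ y i := fun i => by rw [← hi i]; exact le_max_right _ _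
  have hw0 : ∀ i, 0 ≤ (T y + b) i := fun i => by
    have h := le_max_left (y i - τ * (T y + b) i) 0
    rw [hi i] at h
    exact nonneg_of_mul_nonneg_right (by linarith) hτpos
  refine ⟨y, hy0, hw0, ?_⟩
  rw [PiLp.inner_apply]
  refine Finset.sum_eq_zero fun i _ => ?_
  have h0 : y i * (T y + b) i = 0 := by
    rcases max_choice (y i - τ * (T y + b) i) 0 with h | h
    · have h' : τ * (T y + b) i = 0 := by have := hi i; linarith
      rw [(mul_eq_zero.1 h').resolve_left hτpos.ne', mul_zero]
    · rw [hi i] at h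
      rw [h, zero_mul]
  simpa [mul_comm] using h0

variable {A B : Matrix (Fin m) (Fin m) ℝ} {a b y z : Vec m} {ε : ℝ}

lemma lcpSol_add_smul_one_nonempty (hA : ∀ u : Fin m → ℝ, 0 ≤ u ⬝ᵥ A.mulVec u) (hε : 0 < ε)
    (b : Vec m) : (lcpSol (A + ε • (1 : Matrix (Fin m) (Fin m) ℝ)) b).Nonempty := by
  refine lcpSol_nonempty_of_strongly_monotone hε (fun u => ?_) b
  rw [toEuclideanCLM_add_smul_one, inner_add_right, inner_smul_right, real_inner_self_eq_norm_sq]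
  have := inner_toEuclideanCLM_nonneg hA u
  linarith

/-- Pairing the complementarity condition with `y` and dropping the nonnegative term `⟨y, A y⟩`
leaves `ε ‖y‖² ≤ -⟨y, b⟩`. -/
lemma norm_le_of_mem_lcpSol_add_smul_one (hA : ∀ u : Fin m → ℝ, 0 ≤ u ⬝ᵥ A.mulVec u)
    (hy : y ∈ lcpSol (A + ε • (1 : Matrix (Fin m) (Fin m) ℝ)) b) :
    ε * ‖y‖ ≤ ‖b‖ := by
  rw [mem_lcpSol_iff, toEuclideanCLM_add_smul_one] at hy
  have h := hy.2.2
  rw [inner_add_right, inner_add_right, inner_smul_right, real_inner_self_eq_norm_sq] at h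
  have h1 := inner_toEuclideanCLM_nonneg hA y
  have h2 := (abs_le.1 (abs_real_inner_le_norm y b)).1
  rcases (norm_nonneg y).eq_or_lt with h0 | h0
  · rw [← h0, mul_zero]; positivity
  · refine le_of_mul_le_mul_right ?_ h0
    nlinarith

/-- Stability of the solution of a regularized monotone complementarity problem. -/
lemma norm_sub_le_of_mem_lcpSol_add_smul_one (hA : ∀ u : Fin m → ℝ, 0 ≤ u ⬝ᵥ A.mulVec u)
    (hy : y ∈ lcpSol (A + ε • (1 : Matrix (Fin m) (Fin m) ℝ)) a)
    (hz : z ∈ lcpSol (B + ε • (1 : Matrix (Fin m) (Fin m) ℝ)) b) :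
    ε * ‖y - z‖ ≤ ‖Matrix.toEuclideanCLM (𝕜 := ℝ) A - Matrix.toEuclideanCLM (𝕜 := ℝ) B‖ * ‖z‖
      + ‖a - b‖ := by
  have h := inner_sub_sub_nonpos_of_mem_lcpSol hy hz
  rw [toEuclideanCLM_add_smul_one, toEuclideanCLM_add_smul_one] at h
  set S := Matrix.toEuclideanCLM (𝕜 := ℝ) A with hS
  set T := Matrix.toEuclideanCLM (𝕜 := ℝ) B with hT
  -- The operator perturbation is made to act on `z` alone, so that `S` meets only `y - z`, where it
  -- is monotone.
  have e : S y + ε • y + a - (T z + ε • z + b)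
      = S (y - z) + ε • (y - z) + ((S - T) z + (a - b)) := by
    simp only [map_sub, sub_apply]; module
  rw [e, inner_add_right, inner_add_right, inner_smul_right, real_inner_self_eq_norm_sq] at h
  have h1 := inner_toEuclideanCLM_nonneg hA (y - z)
  have h2 := (abs_le.1 (abs_real_inner_le_norm (y - z) ((S - T) z + (a - b)))).1
  have h3 : ‖(S - T) z + (a - b)‖ ≤ ‖S - T‖ * ‖z‖ + ‖a - b‖ :=
    (norm_add_le _ _).trans (by gcongr; exact (S - T).le_opNorm z)
  rcases (norm_nonneg (y - z)).eq_or_lt with h0 | h0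
  · rw [← h0, mul_zero]; positivity
  · refine le_of_mul_le_mul_right ?_ h0
    have h4 := mul_le_mul_of_nonneg_left h3 h0.le
    rw [← hS] at h1
    nlinarith

/-- Monotonicity reduces to `ε ⟨y - z, y⟩ ≤ 0`. The resulting inequality no longer contains `ε`: it
bounds the regularized solutions by any solution and survives the limit `ε → 0`. -/
lemma norm_sq_le_inner_of_mem_lcpSol (hA : ∀ u : Fin m → ℝ, 0 ≤ u ⬝ᵥ A.mulVec u) (hε : 0 < ε)
    (hy : y ∈ lcpSol (A + ε • (1 : Matrix (Fin m) (Fin m) ℝ)) b) (hz : z ∈ lcpSol A b) :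
    ‖y‖ ^ 2 ≤ inner ℝ y z := by
  have h := inner_sub_sub_nonpos_of_mem_lcpSol hy hz
  rw [toEuclideanCLM_add_smul_one] at h
  set S := Matrix.toEuclideanCLM (𝕜 := ℝ) A with hS
  have e : S y + ε • y + b - (S z + b) = S (y - z) + ε • y := by
    simp only [map_sub]; module
  rw [e, inner_add_right, inner_smul_right] at h
  have h1 := inner_toEuclideanCLM_nonneg hA (y - z)
  rw [← hS] at h1
  have h2 : inner ℝ (y - z) y ≤ 0 := by
    by_contra hc
    push Not at hc
    have := mul_pos hε hc
    linarith
  rw [inner_sub_left, real_inner_self_eq_norm_sq, real_inner_comm] at h2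
  linarith

lemma isClosed_lcpSol (A : Matrix (Fin m) (Fin m) ℝ) (b : Vec m) : IsClosed (lcpSol A b) := by
  have : lcpSol A b = (⋂ i, {y : Vec m | 0 ≤ y i}) ∩
      (⋂ i, {y : Vec m | 0 ≤ (Matrix.toEuclideanCLM (𝕜 := ℝ) A y + b) i}) ∩
      {y : Vec m | inner ℝ y (Matrix.toEuclideanCLM (𝕜 := ℝ) A y + b) = 0} := by
    ext y
    simp only [mem_lcpSol_iff, Set.mem_inter_iff, Set.mem_iInter, Set.mem_ofPred_eq, and_assoc]
  rw [this]
  refine ((isClosed_iInter fun i => ?_).inter (isClosed_iInter fun i => ?_)).inter ?_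
  · exact isClosed_le continuous_const (by fun_prop)
  · exact isClosed_le continuous_const (by fun_prop)
  · exact isClosed_eq (by fun_prop) continuous_const

lemma exists_least_norm_mem_lcpSol (h : (lcpSol A b).Nonempty) :
    ∃ y, y ∈ lcpSol A b ∧ ∀ z ∈ lcpSol A b, ‖y‖ ≤ ‖z‖ := by
  obtain ⟨y, hy, hd⟩ := (isClosed_lcpSol A b).exists_infDist_eq_dist h 0
  refine ⟨y, hy, fun z hz => ?_⟩
  have := Metric.infDist_le_dist_of_mem (x := (0 : Vec m)) hz
  rw [hd] at this
  simpa using this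

/-- Tikhonov regularization: the regularized solutions converge to the least norm solution. -/
lemma tendsto_lcpSol_least_norm (hA : ∀ u : Fin m → ℝ, 0 ≤ u ⬝ᵥ A.mulVec u)
    (hz : z ∈ lcpSol A b) (hmin : ∀ w ∈ lcpSol A b, ‖z‖ ≤ ‖w‖)
    {e : ℕ → ℝ} (he : ∀ k, 0 < e k) (he0 : Tendsto e atTop (𝓝 0)) {y : ℕ → Vec m}
    (hy : ∀ k, y k ∈ lcpSol (A + e k • (1 : Matrix (Fin m) (Fin m) ℝ)) b) :
    Tendsto y atTop (𝓝 z) := by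
  have hbd : ∀ k, y k ∈ Metric.closedBall (0 : Vec m) ‖z‖ := fun k => by
    rw [mem_closedBall_zero_iff]
    have h1 := norm_sq_le_inner_of_mem_lcpSol hA (he k) (hy k) hz
    have h2 := real_inner_le_norm (y k) z
    rcases (norm_nonneg (y k)).eq_or_lt with h0 | h0
    · rw [← h0]; positivity
    · exact le_of_mul_le_mul_left (by nlinarith) h0
  -- By compactness it suffices to show that every cluster point `w` equals `z`.
  refine tendsto_of_subseq_tendsto fun ns hns => ?_
  obtain ⟨w, -, φ, hφ, hw⟩ :=
    (isCompact_closedBall (0 : Vec m) ‖z‖).tendsto_subseq fun k => hbd (ns k)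
  refine ⟨φ, ?_⟩
  have hlim : Tendsto (fun k => y (ns (φ k))) atTop (𝓝 w) := hw
  have hidx : Tendsto (fun k => ns (φ k)) atTop atTop := hns.comp hφ.tendsto_atTop
  have hres : Tendsto (fun k => Matrix.toEuclideanCLM (𝕜 := ℝ) A (y (ns (φ k)))
      + e (ns (φ k)) • y (ns (φ k)) + b) atTop (𝓝 (Matrix.toEuclideanCLM (𝕜 := ℝ) A w + b)) := by
    have h := (((Matrix.toEuclideanCLM (𝕜 := ℝ) A).continuous.tendsto w).comp hlim).add
      ((he0.comp hidx).smul hlim) |>.add_const b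
    simpa using h
  have hcoord : ∀ i, Continuous fun v : Vec m => v i := fun i => by fun_prop
  have hmem : w ∈ lcpSol A b := by
    refine mem_lcpSol_iff.2 ⟨fun i => ?_, fun i => ?_, ?_⟩
    · exact ge_of_tendsto' (((hcoord i).tendsto w).comp hlim) fun k => (hy _).1 i
    · refine ge_of_tendsto' (((hcoord i).tendsto _).comp hres) fun k => ?_
      have := (mem_lcpSol_iff.1 (hy (ns (φ k)))).2.1 i
      rwa [toEuclideanCLM_add_smul_one] at this
    · refine tendsto_nhds_unique (hlim.inner hres) ?_
      refine tendsto_const_nhds.congr fun k => ?_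
      have := (mem_lcpSol_iff.1 (hy (ns (φ k)))).2.2
      rw [toEuclideanCLM_add_smul_one] at this
      exact this.symm
  have h1 : ‖w‖ ^ 2 ≤ inner ℝ w z :=
    le_of_tendsto_of_tendsto' (hlim.norm.pow 2) (hlim.inner tendsto_const_nhds) fun k =>
      norm_sq_le_inner_of_mem_lcpSol hA (he _) (hy _) hz
  -- With `h1`, `‖w - z‖² = ‖w‖² - 2⟨w, z⟩ + ‖z‖² ≤ ‖z‖² - ‖w‖² ≤ 0`.
  have h2 := pow_le_pow_left₀ (norm_nonneg z) (hmin w hmem) 2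
  have h3 := norm_sub_sq_real w z
  have h4 : ‖w - z‖ = 0 := by
    have := sq_nonneg ‖w - z‖
    exact pow_eq_zero_iff two_ne_zero |>.1 (by linarith)
  rw [← sub_eq_zero.1 (norm_eq_zero.1 h4)]
  exact hlim

end LCP

/-! ### Bounds, Lipschitz estimates and measurability of `ŷ_ε` and `ȳ` -/

namespace DRMPSCC

variable {n m l ν : ℕ} {V : Type*} [NormedAddCommGroup V] [NormedSpace ℝ V]
  {D : DRMPSCC n m l ν V} {ε : ℝ} {x : Vec n}

lemma yReg_mem (hD : D.Standing) (hε : 0 < ε) (x : Vec n) (ξ : D.Ξ) :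
    D.yReg ε x ξ ∈ lcpSol (D.M ξ + ε • (1 : Matrix (Fin m) (Fin m) ℝ)) (D.q x ξ) :=
  Classical.epsilon_spec (lcpSol_add_smul_one_nonempty (hD.psd_M ξ) hε (D.q x ξ))

lemma yLeast_spec (hD : D.Standing) (hx : x ∈ D.X) (ξ : D.Ξ) :
    D.yLeast x ξ ∈ lcpSol (D.M ξ) (D.q x ξ) ∧
      ∀ z ∈ lcpSol (D.M ξ) (D.q x ξ), ‖D.yLeast x ξ‖ ≤ ‖z‖ :=
  Classical.epsilon_spec (exists_least_norm_mem_lcpSol (hD.recourse x hx ξ))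

lemma isBounded_prod_support (hD : D.Standing) (hΞ : Bornology.IsBounded D.Ξ) :
    Bornology.IsBounded (D.X ×ˢ (Set.univ : Set D.Ξ)) := by
  have : BoundedSpace D.Ξ := boundedSpace_subtype_iff.2 hΞ
  exact hD.compact_X.isBounded.prod (Bornology.IsBounded.all _)

lemma exists_norm_yReg_le (hD : D.Standing) (hΞ : Bornology.IsBounded D.Ξ) (hε : 0 < ε) :
    ∃ R, 0 ≤ R ∧ ∀ x ∈ D.X, ∀ ξ, ‖D.yReg ε x ξ‖ ≤ R := by
  obtain ⟨K, hK⟩ := hD.lip_q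
  obtain ⟨R, hR⟩ := (hK.isBounded_image (isBounded_prod_support hD hΞ)).exists_norm_le
  -- The maximum with `0` covers an empty domain, where the bound `R` may be negative.
  refine ⟨max (R / ε) 0, le_max_right _ _, fun x hx ξ => le_max_of_le_left ?_⟩
  rw [le_div_iff₀' hε]
  exact (norm_le_of_mem_lcpSol_add_smul_one (hD.psd_M ξ) (yReg_mem hD hε x ξ)).trans
    (hR _ ⟨(x, ξ), ⟨hx, trivial⟩, rfl⟩)

/-- The stability estimate becomes a Lipschitz bound once `‖ŷ_ε‖` is bounded uniformly. The constant
`(L R + K) / ε` is used only for fixed `ε`. -/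
lemma exists_norm_yReg_sub_le (hD : D.Standing) (hΞ : Bornology.IsBounded D.Ξ) (hε : 0 < ε) :
    ∃ C, 0 ≤ C ∧ ∀ x ∈ D.X, ∀ x' ∈ D.X, ∀ ξ ξ',
      ‖D.yReg ε x ξ - D.yReg ε x' ξ'‖ ≤ C * (dist x x' + dist ξ ξ') := by
  obtain ⟨R, hR0, hR⟩ := exists_norm_yReg_le hD hΞ hε
  obtain ⟨K, hK⟩ := hD.lip_q
  obtain ⟨L, hL⟩ := hD.lip_M
  refine ⟨(L * R + K) / ε, by positivity, fun x _ x' hx' ξ ξ' => ?_⟩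
  have h := norm_sub_le_of_mem_lcpSol_add_smul_one (hD.psd_M ξ) (yReg_mem hD hε x ξ)
    (yReg_mem hD hε x' ξ')
  have hM : ‖Matrix.toEuclideanCLM (𝕜 := ℝ) (D.M ξ) - Matrix.toEuclideanCLM (𝕜 := ℝ) (D.M ξ')‖
      ≤ L * dist ξ ξ' := by
    rw [← dist_eq_norm]; exact hL.dist_le_mul ξ ξ'
  have hq : ‖D.q x ξ - D.q x' ξ'‖ ≤ K * (dist x x' + dist ξ ξ') := by
    rw [← dist_eq_norm]
    refine (hK.dist_le_mul (x, ξ) (x', ξ')).trans ?_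
    gcongr
    exact max_le_add_of_nonneg dist_nonneg dist_nonneg
  rw [div_mul_eq_mul_div, le_div_iff₀' hε]
  refine h.trans ?_
  have hd : L * dist ξ ξ' * ‖D.yReg ε x' ξ'‖ ≤ L * (dist x x' + dist ξ ξ') * R := by
    gcongr
    · exact le_add_of_nonneg_left dist_nonneg
    · exact hR x' hx' ξ'
  have := mul_le_mul_of_nonneg_right hM (norm_nonneg (D.yReg ε x' ξ'))
  linarith

lemma continuous_yReg (hD : D.Standing) (hΞ : Bornology.IsBounded D.Ξ) (hε : 0 < ε)
    (hx : x ∈ D.X) : Continuous (D.yReg ε x) := by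
  obtain ⟨C, hC0, hC⟩ := exists_norm_yReg_sub_le hD hΞ hε
  refine (LipschitzWith.of_dist_le_mul (K := C.toNNReal) fun ξ ξ' => ?_).continuous
  rw [Real.coe_toNNReal _ hC0, dist_eq_norm]
  simpa using hC x hx x hx ξ ξ'

/-- The map is the pointwise limit of the continuous maps `ŷ_ε(x, ·)` along `ε = 1/(k+1)`, so no
selection theorem is needed. -/
lemma measurable_yLeast (hD : D.Standing) (hΞ : Bornology.IsBounded D.Ξ) (hx : x ∈ D.X) :
    Measurable (D.yLeast x) := by
  have hpos : ∀ k : ℕ, (0 : ℝ) < 1 / (k + 1) := fun k => Nat.one_div_pos_of_nat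
  refine measurable_of_tendsto_metrizable (f := fun k : ℕ => D.yReg (1 / (k + 1)) x)
    (fun k => (continuous_yReg hD hΞ (hpos k) hx).measurable) (tendsto_pi_nhds.2 fun ξ => ?_)
  obtain ⟨h1, h2⟩ := yLeast_spec hD hx ξ
  exact tendsto_lcpSol_least_norm (hD.psd_M ξ) h1 h2 hpos tendsto_one_div_add_atTop_nhds_zero_nat
    fun k => yReg_mem hD (hpos k) x ξ

lemma yLeast_feasible (hD : D.Standing) (hΞ : Bornology.IsBounded D.Ξ) (hx : x ∈ D.X) :
    (x, D.yLeast x) ∈ D.feasible :=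
  ⟨hx, measurable_yLeast hD hΞ hx, fun ξ => (yLeast_spec hD hx ξ).1⟩

lemma exists_norm_f_yReg_le (hD : D.Standing) (hΞ : Bornology.IsBounded D.Ξ)
    (hf : ∃ K, LipschitzWith K fun p : Vec n × Vec m × D.Ξ => D.f p.1 p.2.1 p.2.2) (hε : 0 < ε) :
    ∃ R, 0 ≤ R ∧ ∀ x ∈ D.X, ∀ ξ, ‖D.f x (D.yReg ε x ξ) ξ‖ ≤ R := by
  obtain ⟨K, hK⟩ := hf
  obtain ⟨R, -, hR⟩ := exists_norm_yReg_le hD hΞ hε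
  have : BoundedSpace D.Ξ := boundedSpace_subtype_iff.2 hΞ
  obtain ⟨S, hS⟩ := (hK.isBounded_image (hD.compact_X.isBounded.prod
    ((Metric.isBounded_closedBall (x := (0 : Vec m)) (r := R)).prod
      (Bornology.IsBounded.all (Set.univ : Set D.Ξ))))).exists_norm_le
  refine ⟨max S 0, le_max_right _ _, fun x hx ξ => le_max_of_le_left ?_⟩
  exact hS _ ⟨(x, D.yReg ε x ξ, ξ), ⟨hx, mem_closedBall_zero_iff.2 (hR x hx ξ), trivial⟩, rfl⟩

lemma exists_norm_f_yReg_sub_le (hD : D.Standing) (hΞ : Bornology.IsBounded D.Ξ)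
    (hf : ∃ K, LipschitzWith K fun p : Vec n × Vec m × D.Ξ => D.f p.1 p.2.1 p.2.2) (hε : 0 < ε) :
    ∃ C, 0 ≤ C ∧ ∀ x ∈ D.X, ∀ x' ∈ D.X, ∀ ξ ξ',
      ‖D.f x (D.yReg ε x ξ) ξ - D.f x' (D.yReg ε x' ξ') ξ'‖ ≤ C * (dist x x' + dist ξ ξ') := by
  obtain ⟨K, hK⟩ := hf
  obtain ⟨C, hC0, hC⟩ := exists_norm_yReg_sub_le hD hΞ hε
  refine ⟨K * (C + 1), by positivity, fun x hx x' hx' ξ ξ' => ?_⟩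
  rw [← dist_eq_norm]
  refine (hK.dist_le_mul (x, D.yReg ε x ξ, ξ) (x', D.yReg ε x' ξ', ξ')).trans ?_
  rw [mul_assoc]
  gcongr
  have h := hC x hx x' hx' ξ ξ'
  rw [← dist_eq_norm] at h
  have h1 : 0 ≤ dist x x' := dist_nonneg
  have h2 : 0 ≤ dist ξ ξ' := dist_nonneg
  have h3 : 0 ≤ C * (dist x x' + dist ξ ξ') := by positivity
  refine max_le ?_ (max_le ?_ ?_) <;> dsimp only <;> linarith

lemma continuous_f_yReg (hD : D.Standing) (hΞ : Bornology.IsBounded D.Ξ)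
    (hf : ∃ K, LipschitzWith K fun p : Vec n × Vec m × D.Ξ => D.f p.1 p.2.1 p.2.2) (hε : 0 < ε)
    (hx : x ∈ D.X) : Continuous fun ξ => D.f x (D.yReg ε x ξ) ξ := by
  obtain ⟨K, hK⟩ := hf
  exact hK.continuous.comp
    (continuous_const.prodMk ((continuous_yReg hD hΞ hε hx).prodMk continuous_id))

lemma integrable_f_yReg (hD : D.Standing) (hΞ : Bornology.IsBounded D.Ξ)
    (hf : ∃ K, LipschitzWith K fun p : Vec n × Vec m × D.Ξ => D.f p.1 p.2.1 p.2.2) (hε : 0 < ε)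
    (hx : x ∈ D.X) (P : ProbabilityMeasure D.Ξ) :
    Integrable (fun ξ => D.f x (D.yReg ε x ξ) ξ) (P : Measure D.Ξ) := by
  obtain ⟨R, -, hR⟩ := exists_norm_f_yReg_le hD hΞ hf hε
  exact Integrable.of_bound (continuous_f_yReg hD hΞ hf hε hx).measurable.aestronglyMeasurable R
    (Eventually.of_forall (hR x hx))

lemma integrable_moment (hΞ : Bornology.IsBounded D.Ξ) (hΨ : ∃ K, LipschitzWith K D.Ψ)
    [FiniteDimensional ℝ V] (P : ProbabilityMeasure D.Ξ) : Integrable D.Ψ (P : Measure D.Ξ) := by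
  obtain ⟨K, hK⟩ := hΨ
  have : BoundedSpace D.Ξ := boundedSpace_subtype_iff.2 hΞ
  obtain ⟨S, hS⟩ :=
    (hK.isBounded_image (Bornology.IsBounded.all (Set.univ : Set D.Ξ))).exists_norm_le
  exact Integrable.of_bound hK.continuous.aestronglyMeasurable S
    (Eventually.of_forall fun ξ => hS _ ⟨ξ, trivial, rfl⟩)

end DRMPSCC

/-! ### Comparing worst-case values, and integrals against discrete distributions -/

/-- Comparison of two worst-case objectives distribution by distribution. Since `a`, `b`, `c` are
real, the extended arithmetic is harmless even when a supremum is infinite or over an empty set. -/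
lemma coe_add_biSup_le_of_forall_exists {α β : Type*} {A : Set α} {B : Set β} {u : α → ℝ}
    {v : β → ℝ} {a b c : ℝ} (h : ∀ i ∈ A, ∃ j ∈ B, a + u i ≤ b + v j + c) :
    (a : EReal) + ⨆ i ∈ A, (u i : EReal) ≤ (b : EReal) + (⨆ j ∈ B, (v j : EReal)) + (c : EReal) := by
  rw [add_comm (a : EReal), ← EReal.le_sub_iff_add_le (by simp) (by simp)]
  refine iSup₂_le fun i hi => ?_
  obtain ⟨j, hj, hij⟩ := h i hi
  rw [EReal.le_sub_iff_add_le (by simp) (by simp)]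
  have h1 : (v j : EReal) ≤ ⨆ j ∈ B, (v j : EReal) := le_iSup₂_of_le j hj le_rfl
  calc (u i : EReal) + a = ((a + u i : ℝ) : EReal) := by push_cast; rw [add_comm]
    _ ≤ ((b + v j + c : ℝ) : EReal) := by exact_mod_cast hij
    _ = (b : EReal) + (v j : EReal) + (c : EReal) := by push_cast; rfl
    _ ≤ _ := by gcongr

/-- The cell masses are the weights of the pushforward of `μ` under `t`. -/
lemma sum_measureReal_preimage_smul {α E : Type*} [MeasurableSpace α] [NormedAddCommGroup E]
    [NormedSpace ℝ E] [CompleteSpace E] {k : ℕ} (μ : Measure α) [IsFiniteMeasure μ] {t : α → Fin k}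
    (ht : Measurable t) (g : Fin k → E) :
    ∑ i, μ.real (t ⁻¹' {i}) • g i = ∫ ξ, g (t ξ) ∂μ := by
  have hg : Integrable g (μ.map t) := Integrable.of_finite
  rw [← integral_map ht.aemeasurable hg.aestronglyMeasurable, integral_fintype hg]
  refine Finset.sum_congr rfl fun i _ => ?_
  rw [map_measureReal_apply ht (measurableSet_singleton i)]

lemma integrable_comp_measurable_fin {α E : Type*} [MeasurableSpace α] [NormedAddCommGroup E]
    {k : ℕ} (μ : Measure α) [IsFiniteMeasure μ] {t : α → Fin k} (ht : Measurable t)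
    (g : Fin k → E) : Integrable (fun ξ => g (t ξ)) μ := by
  have hg : Integrable g (μ.map t) := Integrable.of_finite
  exact (integrable_map_measure hg.aestronglyMeasurable ht.aemeasurable).1 hg

lemma integral_sum_smul_dirac {α E : Type*} [MeasurableSpace α] [MeasurableSingletonClass α]
    [NormedAddCommGroup E] [NormedSpace ℝ E] [CompleteSpace E] {k : ℕ} {p : Fin k → ℝ}
    (hp : ∀ i, 0 ≤ p i) (s : Fin k → α) (g : α → E) :
    ∫ ξ, g ξ ∂(∑ i, ENNReal.ofReal (p i) • Measure.dirac (s i)) = ∑ i, p i • g (s i) := by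
  rw [integral_finsetSum_measure fun i _ =>
    (integrable_dirac (by simp)).smul_measure ENNReal.ofReal_ne_top]
  refine Finset.sum_congr rfl fun i _ => ?_
  rw [integral_smul_measure, integral_dirac, ENNReal.toReal_ofReal (hp i)]

lemma norm_integral_sub_integral_le {α E : Type*} [MeasurableSpace α] [NormedAddCommGroup E]
    [NormedSpace ℝ E] {μ : Measure α} [IsProbabilityMeasure μ] {f g : α → E}
    (hf : Integrable f μ) (hg : Integrable g μ) {c : ℝ} (h : ∀ ξ, ‖f ξ - g ξ‖ ≤ c) :
    ‖∫ ξ, f ξ ∂μ - ∫ ξ, g ξ ∂μ‖ ≤ c := by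
  rw [← integral_sub hf hg]
  simpa using norm_integral_le_of_norm_le_const (μ := μ) (Eventually.of_forall h)

/-! ### Discretization of the ambiguity set for fixed `ε` -/

namespace DRMPSCC

variable {n m l ν : ℕ} {V : Type*} [NormedAddCommGroup V] [NormedSpace ℝ V]
  {D : DRMPSCC n m l ν V} {ε : ℝ} {x : Vec n}

/-- Choosing the first index whose sample is close enough gives measurability directly, because
closeness is an open condition on `ξ`. -/
lemma exists_measurable_near_sample [Nonempty D.Ξ] {k : ℕ} (s : Fin k → D.Ξ) {b : ℝ}
    (hs : D.fillDist s < ENNReal.ofReal b) :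
    ∃ t : D.Ξ → Fin k, Measurable t ∧ ∀ ξ, dist ξ (s (t ξ)) ≤ b := by
  classical
  have h1 : ∀ ξ : D.Ξ, ∃ i, edist ξ (s i) < ENNReal.ofReal b := fun ξ =>
    iInf_lt_iff.1 ((le_iSup (fun ξ : D.Ξ => ⨅ i : Fin k, edist ξ (s i)) ξ).trans_lt hs)
  obtain ⟨i₀, -⟩ := h1 (Classical.arbitrary _)
  -- Indices are extended to `ℕ` for `Nat.find`; since some index below `k` qualifies, the padding
  -- value `i₀` is never reached by padding.
  let τ : ℕ → Fin k := fun N => if h : N < k then ⟨N, h⟩ else i₀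
  have h2 : ∀ ξ : D.Ξ, ∃ N, edist ξ (s (τ N)) < ENNReal.ofReal b := fun ξ => by
    obtain ⟨i, hi⟩ := h1 ξ
    exact ⟨i, by simpa [τ] using hi⟩
  refine ⟨fun ξ => τ (Nat.find (h2 ξ)), ?_, fun ξ => ?_⟩
  · refine (measurable_from_top (f := τ)).comp (measurable_find h2 fun N => ?_)
    exact (isOpen_lt (by fun_prop) continuous_const).measurableSet
  · have h := Nat.find_spec (h2 ξ)
    rw [edist_dist] at h
    exact (ENNReal.ofReal_lt_ofReal_iff'.1 h).1.le

/-- Discrete distributions on the samples are elements of the ambiguity set. -/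
lemma exists_ambiguity_of_ambiguityDisc (hΞ : Bornology.IsBounded D.Ξ)
    (hΨ : ∃ K, LipschitzWith K D.Ψ) [FiniteDimensional ℝ V] {k : ℕ} {s : Fin k → D.Ξ}
    {p : Fin k → ℝ} (hp : p ∈ D.ambiguityDisc s) :
    ∃ P ∈ D.ambiguity, ∀ g : D.Ξ → Vec l,
      ∫ ξ, g ξ ∂(P : Measure D.Ξ) = ∑ i, p i • g (s i) := by
  obtain ⟨hp0, hp1, hpΓ⟩ := hp
  let μ : Measure D.Ξ := ∑ i, ENNReal.ofReal (p i) • Measure.dirac (s i)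
  have hμ : IsProbabilityMeasure μ := ⟨by
    simp only [μ, Measure.coe_finsetSum, Finset.sum_apply, Measure.smul_apply, measure_univ,
      smul_eq_mul, mul_one]
    rw [← ENNReal.ofReal_sum_of_nonneg fun i _ => hp0 i, hp1, ENNReal.ofReal_one]⟩
  have : CompleteSpace V := FiniteDimensional.complete ℝ V
  refine ⟨⟨μ, hμ⟩, ⟨integrable_moment hΞ hΨ _, ?_⟩,
    integral_sum_smul_dirac hp0 s⟩
  have h := integral_sum_smul_dirac hp0 s D.Ψ
  change ∫ ξ, D.Ψ ξ ∂μ ∈ D.Γ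
  rwa [h]

/-- Under the Slater condition every distribution of the ambiguity set is approximated by discrete
distributions on fine samples that satisfy the moment constraint. -/
lemma exists_ambiguityDisc_near (hΞ : Bornology.IsBounded D.Ξ) [FiniteDimensional ℝ V]
    (hSlater : D.Slater) (hΨ : ∃ K, LipschitzWith K D.Ψ) {lam : ℝ} (h0 : 0 < lam) (h1 : lam < 1) :
    ∃ b₀ > 0, ∀ b ≤ b₀, ∀ (k : ℕ) (s : Fin k → D.Ξ), D.fillDist s < ENNReal.ofReal b →
      ∀ P ∈ D.ambiguity, ∃ p ∈ D.ambiguityDisc s, ∀ (g : D.Ξ → Vec l) (R C : ℝ), 0 ≤ C →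
        (∀ ξ, ‖g ξ‖ ≤ R) → (∀ ξ ξ', ‖g ξ - g ξ'‖ ≤ C * dist ξ ξ') →
        ‖∑ i, p i • g (s i) - ∫ ξ, g ξ ∂(P : Measure D.Ξ)‖ ≤ C * b + lam * (2 * R) := by
  obtain ⟨P₀, α, hα, hP₀, hball⟩ := hSlater
  obtain ⟨K, hK⟩ := hΨ
  have hne : Nonempty D.Ξ := (P₀ : Measure D.Ξ).nonempty_of_neZero
  -- This makes the moment error `K b` at most `lam * α`; the `+ 1` avoids division by zero.
  refine ⟨lam * α / (K + 1), by positivity, fun b hb k s hs P hP => ?_⟩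
  obtain ⟨t, ht, htb⟩ := exists_measurable_near_sample s hs
  have hb0 : 0 ≤ b := dist_nonneg.trans (htb (Classical.arbitrary _))
  -- Weights of the pushforward under `t` of the mixture `(1 - lam) P + lam P₀`.
  let p : Fin k → ℝ := fun i => (1 - lam) * (P : Measure D.Ξ).real (t ⁻¹' {i})
    + lam * (P₀ : Measure D.Ξ).real (t ⁻¹' {i})
  have : CompleteSpace V := FiniteDimensional.complete ℝ V
  have hsumV : ∑ i, p i • D.Ψ (s i) = (1 - lam) • ∫ ξ, D.Ψ (s (t ξ)) ∂(P : Measure D.Ξ)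
      + lam • ∫ ξ, D.Ψ (s (t ξ)) ∂(P₀ : Measure D.Ξ) := by
    simp only [p, add_smul, mul_smul, Finset.sum_add_distrib, ← Finset.smul_sum]
    rw [sum_measureReal_preimage_smul _ ht fun i => D.Ψ (s i),
      sum_measureReal_preimage_smul _ ht fun i => D.Ψ (s i)]
  have hsum : ∀ g : D.Ξ → Vec l, ∑ i, p i • g (s i)
      = (1 - lam) • ∫ ξ, g (s (t ξ)) ∂(P : Measure D.Ξ)
        + lam • ∫ ξ, g (s (t ξ)) ∂(P₀ : Measure D.Ξ) := by
    intro g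
    simp only [p, add_smul, mul_smul, Finset.sum_add_distrib, ← Finset.smul_sum]
    rw [sum_measureReal_preimage_smul _ ht fun i => g (s i),
      sum_measureReal_preimage_smul _ ht fun i => g (s i)]
  have hone : ∀ Q : ProbabilityMeasure D.Ξ, ∑ i, (Q : Measure D.Ξ).real (t ⁻¹' {i}) = 1 := by
    intro Q
    simpa using sum_measureReal_preimage_smul (Q : Measure D.Ξ) ht fun _ => (1 : ℝ)
  refine ⟨p, ⟨fun i => ?_, ?_, ?_⟩, fun g R C hC hR hg => ?_⟩
  · have : 0 ≤ 1 - lam := by linarith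
    positivity
  · simp only [p, Finset.sum_add_distrib, ← Finset.mul_sum, hone]
    ring
  · have hΨd : ∀ Q : ProbabilityMeasure D.Ξ, ‖∫ ξ, D.Ψ (s (t ξ)) ∂(Q : Measure D.Ξ)
        - ∫ ξ, D.Ψ ξ ∂(Q : Measure D.Ξ)‖ ≤ K * b := fun Q => by
      refine norm_integral_sub_integral_le (integrable_comp_measurable_fin _ ht fun i => D.Ψ (s i))
        (integrable_moment hΞ ⟨K, hK⟩ Q) fun ξ => ?_
      rw [← dist_eq_norm, dist_comm]
      exact (hK.dist_le_mul _ _).trans (by gcongr; exact htb ξ)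
    -- The total moment error. As `‖lam⁻¹ • e‖ ≤ α`, it can be charged to the `P₀` part, whose
    -- perturbed moment stays in `Γ`.
    set e : V := (1 - lam) • (∫ ξ, D.Ψ (s (t ξ)) ∂(P : Measure D.Ξ)
        - ∫ ξ, D.Ψ ξ ∂(P : Measure D.Ξ)) + lam • (∫ ξ, D.Ψ (s (t ξ)) ∂(P₀ : Measure D.Ξ)
        - ∫ ξ, D.Ψ ξ ∂(P₀ : Measure D.Ξ)) with he
    have hen : ‖e‖ ≤ lam * α := by
      have hb' : K * b ≤ lam * α := by
        rw [le_div_iff₀ (by positivity)] at hb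
        linarith
      refine (norm_add_le _ _).trans ?_
      rw [norm_smul, norm_smul, Real.norm_of_nonneg h0.le, Real.norm_of_nonneg (by linarith)]
      have := mul_le_mul_of_nonneg_left (hΨd P) (by linarith : 0 ≤ 1 - lam)
      have := mul_le_mul_of_nonneg_left (hΨd P₀) h0.le
      linarith
    have hmem := hball (lam⁻¹ • e) (by
      rw [norm_smul, norm_inv, Real.norm_of_nonneg h0.le, inv_mul_le_iff₀ h0]
      exact hen)
    have hcomb := D.Γ.add_mem (D.Γ.smul_mem (by linarith : 0 < 1 - lam) hP.2)
      (D.Γ.smul_mem h0 hmem)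
    have heq : ∑ i, p i • D.Ψ (s i) = (1 - lam) • ∫ ξ, D.Ψ ξ ∂(P : Measure D.Ξ)
        + lam • (∫ ξ, D.Ψ ξ ∂(P₀ : Measure D.Ξ) + lam⁻¹ • e) := by
      rw [smul_add, smul_inv_smul₀ h0.ne', hsumV, he]
      module
    rwa [heq]
  · have hCb : ∀ ξ, ‖g (s (t ξ)) - g ξ‖ ≤ C * b := fun ξ => by
      rw [norm_sub_rev]
      exact (hg _ _).trans (by gcongr; exact htb ξ)
    have hgc : Continuous g := by
      refine (LipschitzWith.of_dist_le_mul (K := C.toNNReal) fun ξ ξ' => ?_).continuous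
      rw [Real.coe_toNNReal _ hC, dist_eq_norm]
      exact hg ξ ξ'
    have hgP : Integrable g (P : Measure D.Ξ) :=
      Integrable.of_bound hgc.aestronglyMeasurable R (Eventually.of_forall hR)
    have hd := norm_integral_sub_integral_le (integrable_comp_measurable_fin _ ht fun i => g (s i)) hgP hCb
    have hn : ∀ Q : ProbabilityMeasure D.Ξ, ‖∫ ξ, g (s (t ξ)) ∂(Q : Measure D.Ξ)‖ ≤ R := fun Q => by
      simpa using norm_integral_le_of_norm_le_const (μ := (Q : Measure D.Ξ))
        (Eventually.of_forall fun ξ => hR (s (t ξ)))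
    rw [hsum]
    -- Transport error, at most `C * b`, plus mixing error, at most `lam * (2 * R)`.
    have heq : (1 - lam) • ∫ ξ, g (s (t ξ)) ∂(P : Measure D.Ξ)
        + lam • ∫ ξ, g (s (t ξ)) ∂(P₀ : Measure D.Ξ) - ∫ ξ, g ξ ∂(P : Measure D.Ξ)
        = (∫ ξ, g (s (t ξ)) ∂(P : Measure D.Ξ) - ∫ ξ, g ξ ∂(P : Measure D.Ξ))
          + lam • (∫ ξ, g (s (t ξ)) ∂(P₀ : Measure D.Ξ)
            - ∫ ξ, g (s (t ξ)) ∂(P : Measure D.Ξ)) := by module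
    rw [heq]
    refine (norm_add_le _ _).trans (add_le_add hd ?_)
    rw [norm_smul, Real.norm_of_nonneg h0.le]
    gcongr
    exact (norm_sub_le _ _).trans (by have := hn P; have := hn P₀; linarith)

lemma ΦRegDisc_le (hΞ : Bornology.IsBounded D.Ξ) (hΨ : ∃ K, LipschitzWith K D.Ψ)
    [FiniteDimensional ℝ V] {k : ℕ} (s : Fin k → D.Ξ) (ε : ℝ) (x : Vec n) :
    D.ΦRegDisc s ε x ≤ D.Φ x (D.yReg ε x) := by
  have h := coe_add_biSup_le_of_forall_exists (A := D.ambiguityDisc s) (B := D.ambiguity)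
    (u := fun p => D.h (∑ i, p i • D.f x (D.yReg ε x (s i)) (s i)))
    (v := fun P => D.h (∫ ξ, D.f x (D.yReg ε x ξ) ξ ∂(P : Measure D.Ξ)))
    (a := D.θ x) (b := D.θ x) (c := 0) (fun p hp => by
      obtain ⟨P, hP, hint⟩ := exists_ambiguity_of_ambiguityDisc hΞ hΨ hp
      refine ⟨P, hP, ?_⟩
      rw [hint fun ξ => D.f x (D.yReg ε x ξ) ξ, add_zero])
  rwa [EReal.coe_zero, add_zero] at h

/-- The bounds `R` and `C` on the integrand hold for all `x ∈ X`, so a single threshold for `k`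
serves every `x`. -/
lemma eventually_le_ΦRegDisc_add (hD : D.Standing) (hΞ : Bornology.IsBounded D.Ξ)
    (hf : ∃ K, LipschitzWith K fun p : Vec n × Vec m × D.Ξ => D.f p.1 p.2.1 p.2.2)
    [FiniteDimensional ℝ V] (hSlater : D.Slater) (hΨ : ∃ K, LipschitzWith K D.Ψ)
    {s : (k : ℕ) → Fin k → D.Ξ} (hs : Tendsto (fun k => D.fillDist (s k)) atTop (𝓝 0))
    (hε : 0 < ε) {η : ℝ} (hη : 0 < η) :
    ∀ᶠ k in atTop, ∀ x ∈ D.X, D.Φ x (D.yReg ε x) ≤ D.ΦRegDisc (s k) ε x + (η : EReal) := by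
  obtain ⟨R, hR0, hR⟩ := exists_norm_f_yReg_le hD hΞ hf hε
  obtain ⟨C, hC0, hC⟩ := exists_norm_f_yReg_sub_le hD hΞ hf hε
  obtain ⟨K, hK⟩ := hD.lip_h
  have hK0 : (0 : ℝ) ≤ K := K.2
  -- Half of `η` pays for mixing with `P₀`, the other half, through `b`, for transport to the
  -- samples.
  set lam : ℝ := min (1 / 2) (η / (4 * (K * R) + 1)) with hlam
  have hl0 : 0 < lam := lt_min (by norm_num) (by positivity)
  have hl1 : lam < 1 := (min_le_left _ _).trans_lt (by norm_num)
  have hl2 : K * (lam * (2 * R)) ≤ η / 2 := by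
    have h : lam * (4 * (K * R) + 1) ≤ η :=
      (le_div_iff₀ (by positivity)).1 (min_le_right _ _)
    nlinarith
  obtain ⟨b₀, hb₀, hb⟩ := exists_ambiguityDisc_near hΞ hSlater hΨ hl0 hl1
  set b : ℝ := min b₀ (η / (2 * (K * C) + 1)) with hbdef
  have hbpos : 0 < b := lt_min hb₀ (by positivity)
  have hb2 : K * (C * b) ≤ η / 2 := by
    have h : b * (2 * (K * C) + 1) ≤ η :=
      (le_div_iff₀ (by positivity)).1 (min_le_right _ _)
    nlinarith
  filter_upwards [hs.eventually_lt_const (ENNReal.ofReal_pos.2 hbpos)] with k hk x hx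
  refine coe_add_biSup_le_of_forall_exists fun P hP => ?_
  obtain ⟨p, hp, hpg⟩ := hb b (min_le_left _ _) k (s k) hk P hP
  refine ⟨p, hp, ?_⟩
  have h1 := hpg (fun ξ => D.f x (D.yReg ε x ξ) ξ) R C hC0 (hR x hx) fun ξ ξ' => by
    simpa using hC x hx x hx ξ ξ'
  have h2 := hK.dist_le_mul (∑ i, p i • D.f x (D.yReg ε x (s k i)) (s k i))
    (∫ ξ, D.f x (D.yReg ε x ξ) ξ ∂(P : Measure D.Ξ))
  rw [Real.dist_eq, dist_eq_norm] at h2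
  have h3 := mul_le_mul_of_nonneg_left h1 hK0
  have h4 := (abs_le.1 h2).1
  linarith

end DRMPSCC

/-! ### Extended-real limits, `L¹` versus `L²`, and near-minimizers -/

/-- Stated by addition so that an infinite limit is allowed: for empty `X` all the infima are `⊤`.
-/
lemma EReal.tendsto_nhds_of_le_of_forall_eventually_le_add {ι : Type*} {F : Filter ι}
    {a : ι → EReal} {b : EReal} (hle : ∀ i, a i ≤ b)
    (h : ∀ η : ℝ, 0 < η → ∀ᶠ i in F, b ≤ a i + (η : EReal)) : Tendsto a F (𝓝 b) := by
  refine tendsto_order.2 ⟨fun c hc => ?_, fun c hc => Eventually.of_forall fun i =>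
    (hle i).trans_lt hc⟩
  obtain ⟨d, hcd, hdb⟩ := EReal.lt_iff_exists_real_btwn.1 hc
  obtain ⟨d', hdd, hdb'⟩ := EReal.lt_iff_exists_real_btwn.1 hdb
  have hdd' : d < d' := by exact_mod_cast hdd
  filter_upwards [h (d' - d) (by linarith)] with i hi
  refine hcd.trans_le (le_of_not_gt fun hlt => ?_)
  have h1 : a i + ((d' - d : ℝ) : EReal) < (d : EReal) + ((d' - d : ℝ) : EReal) :=
    EReal.add_lt_add_right_coe hlt _
  rw [← EReal.coe_add, add_sub_cancel] at h1
  exact lt_irrefl _ ((hdb'.trans_le hi).trans h1)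

lemma lintegral_enorm_le_of_lintegral_sq_le {α E : Type*} [MeasurableSpace α]
    [NormedAddCommGroup E] {μ : Measure α} [IsProbabilityMeasure μ] {u : α → E}
    (hu : AEStronglyMeasurable u μ) {η : ℝ} (hη : 0 ≤ η)
    (h : ∫⁻ ξ, ‖u ξ‖ₑ ^ 2 ∂μ ≤ ENNReal.ofReal (η ^ 2)) :
    ∫⁻ ξ, ‖u ξ‖ₑ ∂μ ≤ ENNReal.ofReal η := by
  rw [← eLpNorm_one_eq_lintegral_enorm]
  refine (eLpNorm_le_eLpNorm_of_exponent_le (q := 2) (by norm_num) hu).trans ?_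
  have h2 := eLpNorm_nnreal_pow_eq_lintegral (f := u) (μ := μ) (p := 2) two_ne_zero
  simp only [NNReal.coe_ofNat, ENNReal.rpow_ofNat, ENNReal.coe_ofNat] at h2
  rw [← h2, ENNReal.ofReal_pow hη] at h
  exact (ENNReal.pow_le_pow_left_iff two_ne_zero).1 h

/-- Near-minimizers of a continuous function on a compact set are close to the minimizers. -/
lemma IsCompact.exists_forall_infEDist_le {E : Type*} [PseudoEMetricSpace E] {X : Set E}
    (hX : IsCompact X) {φ : E → ℝ} (hφ : ContinuousOn φ X) {z : E}
    (hmin : ∀ x ∈ X, φ z ≤ φ x) {δ : ENNReal} (hδ : 0 < δ) :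
    ∃ η > 0, ∀ x ∈ X, φ x ≤ φ z + η →
      Metric.infEDist x {w | w ∈ X ∧ ∀ x ∈ X, φ w ≤ φ x} ≤ δ := by
  set S := {w | w ∈ X ∧ ∀ x ∈ X, φ w ≤ φ x}
  have hK : IsCompact (X ∩ {x | δ ≤ Metric.infEDist x S}) :=
    hX.inter_right (isClosed_le continuous_const Metric.continuous_infEDist)
  rcases (X ∩ {x | δ ≤ Metric.infEDist x S}).eq_empty_or_nonempty with he | hne
  · refine ⟨1, one_pos, fun x hx _ => le_of_not_ge fun h => ?_⟩
    exact Set.notMem_empty x (he ▸ ⟨hx, h⟩)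
  · obtain ⟨w, ⟨hwX, hwδ⟩, hw⟩ := hK.exists_isMinOn hne (hφ.mono Set.inter_subset_left)
    -- A point at distance at least `δ` from the argmin cannot be a minimizer; half of this gap
    -- serves as `η`.
    have hzw : φ z < φ w := by
      by_contra hc
      have hwS : w ∈ S := ⟨hwX, fun x hx => (not_lt.1 hc).trans (hmin x hx)⟩
      have hwδ' : δ ≤ Metric.infEDist w S := hwδ
      rw [Metric.infEDist_zero_of_mem hwS] at hwδ'
      exact absurd hδ (not_lt.2 hwδ')
    refine ⟨(φ w - φ z) / 2, by linarith, fun x hx hxw => le_of_not_ge fun h => ?_⟩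
    have : φ w ≤ φ x := hw ⟨hx, h⟩
    linarith

/-! ### The limit `ε ↓ 0` for values and minimizers -/

namespace DRMPSCC

variable {n m l ν : ℕ} {V : Type*} [NormedAddCommGroup V] [NormedSpace ℝ V]
  {D : DRMPSCC n m l ν V} {ε : ℝ} {x : Vec n}

/-- The constant is the product of the Lipschitz constants of `h` and `f`. It involves neither `ε`
nor `x`, which is what lets the estimate survive `ε ↓ 0`. -/
lemma exists_Φ_near_yReg (hD : D.Standing) (hΞ : Bornology.IsBounded D.Ξ)
    (hf : ∃ K, LipschitzWith K fun p : Vec n × Vec m × D.Ξ => D.f p.1 p.2.1 p.2.2) :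
    ∃ C : ℝ, 0 ≤ C ∧ ∀ ε > 0, ∀ x ∈ D.X, ∀ (y : D.Ξ → Vec m) (η : ℝ), 0 ≤ η → Measurable y →
      (∀ P ∈ D.ambiguity, ∫⁻ ξ, ‖D.yReg ε x ξ - y ξ‖ₑ ^ 2 ∂(P : Measure D.Ξ)
        ≤ ENNReal.ofReal (η ^ 2)) →
      D.Φ x (D.yReg ε x) ≤ D.Φ x y + ((C * η : ℝ) : EReal) ∧
        D.Φ x y ≤ D.Φ x (D.yReg ε x) + ((C * η : ℝ) : EReal) := by
  obtain ⟨K, hK⟩ := id hf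
  obtain ⟨L, hL⟩ := hD.lip_h
  refine ⟨L * K, by positivity, fun ε hε x hx y η hη hy hP => ?_⟩
  have key : ∀ P ∈ D.ambiguity, |D.h (∫ ξ, D.f x (D.yReg ε x ξ) ξ ∂(P : Measure D.Ξ))
      - D.h (∫ ξ, D.f x (y ξ) ξ ∂(P : Measure D.Ξ))| ≤ L * K * η := by
    intro P hPa
    have hu := lintegral_enorm_le_of_lintegral_sq_le
      ((continuous_yReg hD hΞ hε hx).measurable.sub hy).aestronglyMeasurable hη (hP P hPa)
    have h1 := integrable_f_yReg hD hΞ hf hε hx P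
    have hm : Measurable fun ξ => D.f x (y ξ) ξ :=
      hK.continuous.measurable.comp (measurable_const.prodMk (hy.prodMk measurable_id))
    have hle : ∫⁻ ξ, ‖D.f x (D.yReg ε x ξ) ξ - D.f x (y ξ) ξ‖ₑ ∂(P : Measure D.Ξ)
        ≤ ENNReal.ofReal (K * η) := by
      calc ∫⁻ ξ, ‖D.f x (D.yReg ε x ξ) ξ - D.f x (y ξ) ξ‖ₑ ∂(P : Measure D.Ξ)
          ≤ ∫⁻ ξ, K * ‖D.yReg ε x ξ - y ξ‖ₑ ∂(P : Measure D.Ξ) := by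
            refine lintegral_mono fun ξ => ?_
            rw [← edist_eq_enorm_sub, ← edist_eq_enorm_sub]
            refine (hK (x, D.yReg ε x ξ, ξ) (x, y ξ, ξ)).trans_eq ?_
            simp [Prod.edist_eq]
        _ = K * ∫⁻ ξ, ‖D.yReg ε x ξ - y ξ‖ₑ ∂(P : Measure D.Ξ) :=
            lintegral_const_mul' _ _ ENNReal.coe_ne_top
        _ ≤ K * ENNReal.ofReal η := by gcongr; exact hu
        _ = ENNReal.ofReal (K * η) := by
            rw [ENNReal.ofReal_mul K.coe_nonneg, ENNReal.ofReal_coe_nnreal]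
    -- Here `y` need not be feasible, so integrability of `f(x, y)` is deduced from that of `f(x,
    -- ŷ_ε)` and of the difference.
    have hsub : Integrable (fun ξ => D.f x (D.yReg ε x ξ) ξ - D.f x (y ξ) ξ) (P : Measure D.Ξ) :=
      ⟨h1.aestronglyMeasurable.sub hm.aestronglyMeasurable, hle.trans_lt ENNReal.ofReal_lt_top⟩
    have h2 : Integrable (fun ξ => D.f x (y ξ) ξ) (P : Measure D.Ξ) := by
      refine (h1.sub hsub).congr (Eventually.of_forall fun ξ => ?_)
      simp
    have h3 : ‖∫ ξ, D.f x (D.yReg ε x ξ) ξ ∂(P : Measure D.Ξ)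
        - ∫ ξ, D.f x (y ξ) ξ ∂(P : Measure D.Ξ)‖ ≤ K * η := by
      rw [← integral_sub h1 h2]
      have h4 := (enorm_integral_le_lintegral_enorm _).trans hle
      rw [← ofReal_norm] at h4
      exact (ENNReal.ofReal_le_ofReal_iff (by positivity)).1 h4
    have h4 := hL.dist_le_mul (∫ ξ, D.f x (D.yReg ε x ξ) ξ ∂(P : Measure D.Ξ))
      (∫ ξ, D.f x (y ξ) ξ ∂(P : Measure D.Ξ))
    rw [Real.dist_eq, dist_eq_norm] at h4
    rw [mul_assoc]
    exact h4.trans (by gcongr)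
  exact ⟨coe_add_biSup_le_of_forall_exists fun P hPa =>
      ⟨P, hPa, by have := (abs_le.1 (key P hPa)).2; linarith⟩,
    coe_add_biSup_le_of_forall_exists fun P hPa =>
      ⟨P, hPa, by have := (abs_le.1 (key P hPa)).1; linarith⟩⟩

lemma tendsto_optValRegDisc (hD : D.Standing) (hΞ : Bornology.IsBounded D.Ξ)
    (hf : ∃ K, LipschitzWith K fun p : Vec n × Vec m × D.Ξ => D.f p.1 p.2.1 p.2.2)
    [FiniteDimensional ℝ V] (hSlater : D.Slater) (hΨ : ∃ K, LipschitzWith K D.Ψ)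
    {s : (k : ℕ) → Fin k → D.Ξ} (hs : Tendsto (fun k => D.fillDist (s k)) atTop (𝓝 0))
    (hε : 0 < ε) :
    Tendsto (fun k => D.optValRegDisc (s k) ε) atTop (𝓝 (⨅ x ∈ D.X, D.Φ x (D.yReg ε x))) := by
  refine EReal.tendsto_nhds_of_le_of_forall_eventually_le_add
    (fun k => iInf₂_mono fun x _ => ΦRegDisc_le hΞ hΨ (s k) ε x) fun η hη => ?_
  filter_upwards [eventually_le_ΦRegDisc_add hD hΞ hf hSlater hΨ hs hε hη] with k hk
  rw [← EReal.sub_le_iff_le_add (.inl (EReal.coe_ne_bot _)) (.inl (EReal.coe_ne_top _))]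
  refine le_iInf₂ fun x hx => ?_
  rw [EReal.sub_le_iff_le_add (.inl (EReal.coe_ne_bot _)) (.inl (EReal.coe_ne_top _))]
  exact (iInf₂_le x hx).trans (hk x hx)

lemma auxVal_le (hD : D.Standing) (hΞ : Bornology.IsBounded D.Ξ) (hε : 0 < ε) (r : ℝ) :
    D.auxVal ε r ≤ ⨅ x ∈ D.X, D.Φ x (D.yReg ε x) := by
  refine iInf₂_mono fun x hx => iInf₂_le (D.yReg ε x) ⟨?_, ?_⟩
  · exact (continuous_yReg hD hΞ hε hx).measurable
  · simp

/-- A squeeze between `ϑ_ε` and `ϑ_ε + C √r_ε`; the lower bound holds because `ŷ_ε` is itself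
admissible in the auxiliary problem. -/
lemma tendsto_iInf_Φ_yReg (hD : D.Standing) (hΞ : Bornology.IsBounded D.Ξ)
    (hf : ∃ K, LipschitzWith K fun p : Vec n × Vec m × D.Ξ => D.f p.1 p.2.1 p.2.2)
    {r : ℝ → ℝ} (hr_pos : ∀ ε, 0 < ε → 0 < r ε) (hr : Tendsto r (𝓝[>] 0) (𝓝 0))
    {v : EReal} (haux : Tendsto (fun ε => D.auxVal ε (r ε)) (𝓝[>] 0) (𝓝 v)) :
    Tendsto (fun ε => ⨅ x ∈ D.X, D.Φ x (D.yReg ε x)) (𝓝[>] 0) (𝓝 v) := by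
  obtain ⟨C, -, hC⟩ := exists_Φ_near_yReg hD hΞ hf
  have hc : Tendsto (fun ε => ((C * Real.sqrt (r ε) : ℝ) : EReal)) (𝓝[>] 0) (𝓝 (0 : ℝ)) := by
    refine (continuous_coe_real_ereal.tendsto _).comp ?_
    simpa using ((Real.continuous_sqrt.tendsto 0).comp hr).const_mul C
  have hup : Tendsto (fun ε => D.auxVal ε (r ε) + ((C * Real.sqrt (r ε) : ℝ) : EReal))
      (𝓝[>] 0) (𝓝 v) := by
    have h := (EReal.continuousAt_add (p := (v, ((0 : ℝ) : EReal))) (by simp) (by simp)).tendsto.comp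
      (haux.prodMk_nhds hc)
    simpa [Function.comp_def] using h
  refine tendsto_of_tendsto_of_tendsto_of_le_of_le' haux hup ?_ ?_
  · filter_upwards [self_mem_nhdsWithin] with ε hε
    exact auxVal_le hD hΞ hε _
  · filter_upwards [self_mem_nhdsWithin] with ε hε
    rw [← EReal.sub_le_iff_le_add (.inl (EReal.coe_ne_bot _)) (.inl (EReal.coe_ne_top _))]
    refine le_iInf₂ fun x hx => le_iInf₂ fun y hy => ?_
    rw [EReal.sub_le_iff_le_add (.inl (EReal.coe_ne_bot _)) (.inl (EReal.coe_ne_top _))]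
    refine (iInf₂_le x hx).trans (hC ε hε x hx y _ (Real.sqrt_nonneg _) hy.1 fun P hP => ?_).1
    rw [Real.sq_sqrt (hr_pos ε hε).le]
    exact (le_iSup₂ (f := fun (P : ProbabilityMeasure D.Ξ) (_ : P ∈ D.ambiguity) =>
      ∫⁻ ξ, ‖D.yReg ε x ξ - y ξ‖ₑ ^ 2 ∂(P : Measure D.Ξ)) P hP).trans hy.2

lemma eventually_Φ_yLeast_near (hD : D.Standing) (hΞ : Bornology.IsBounded D.Ξ)
    (hf : ∃ K, LipschitzWith K fun p : Vec n × Vec m × D.Ξ => D.f p.1 p.2.1 p.2.2)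
    (h : Tendsto (fun ε => ⨆ x ∈ D.X, ⨆ P ∈ D.ambiguity,
      ∫⁻ ξ, ‖D.yReg ε x ξ - D.yLeast x ξ‖ₑ ^ 2 ∂(P : Measure D.Ξ)) (𝓝[>] 0) (𝓝 0))
    {η : ℝ} (hη : 0 < η) :
    ∀ᶠ ε in 𝓝[>] 0, ∀ x ∈ D.X,
      D.Φ x (D.yReg ε x) ≤ D.Φ x (D.yLeast x) + (η : EReal) ∧
        D.Φ x (D.yLeast x) ≤ D.Φ x (D.yReg ε x) + (η : EReal) := by
  obtain ⟨C, hC0, hC⟩ := exists_Φ_near_yReg hD hΞ hf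
  have hη' : 0 < η / (C + 1) := by positivity
  have hle : ((C * (η / (C + 1)) : ℝ) : EReal) ≤ (η : EReal) := by
    rw [EReal.coe_le_coe_iff, mul_div_assoc', div_le_iff₀ (by positivity)]
    nlinarith
  filter_upwards [self_mem_nhdsWithin,
    h.eventually_lt_const (ENNReal.ofReal_pos.2 (pow_pos hη' 2))] with ε hε hlt x hx
  have hx' := hC ε hε x hx (D.yLeast x) _ hη'.le (measurable_yLeast hD hΞ hx) fun P hP =>
    ((le_iSup₂ (f := fun (P : ProbabilityMeasure D.Ξ) (_ : P ∈ D.ambiguity) =>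
      ∫⁻ ξ, ‖D.yReg ε x ξ - D.yLeast x ξ‖ₑ ^ 2 ∂(P : Measure D.Ξ)) P hP).trans
      (le_iSup₂ (f := fun (x : Vec n) (_ : x ∈ D.X) => ⨆ P ∈ D.ambiguity,
        ∫⁻ ξ, ‖D.yReg ε x ξ - D.yLeast x ξ‖ₑ ^ 2 ∂(P : Measure D.Ξ)) x hx)).trans hlt.le
  exact ⟨hx'.1.trans (by gcongr), hx'.2.trans (by gcongr)⟩

/-- Boundedness of `f(x, ŷ_ε)` excludes `⊤`; a member of `𝒫` excludes `⊥`, the supremum over the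
empty set. -/
lemma exists_coe_eq_Φ_yReg (hD : D.Standing) (hΞ : Bornology.IsBounded D.Ξ)
    (hf : ∃ K, LipschitzWith K fun p : Vec n × Vec m × D.Ξ => D.f p.1 p.2.1 p.2.2)
    (hP : D.ambiguity.Nonempty) (hε : 0 < ε) (hx : x ∈ D.X) :
    ∃ c : ℝ, D.Φ x (D.yReg ε x) = (c : EReal) := by
  obtain ⟨R, hR0, hR⟩ := exists_norm_f_yReg_le hD hΞ hf hε
  obtain ⟨L, hL⟩ := hD.lip_h
  obtain ⟨P₀, hP₀⟩ := hP
  have hub : D.Φ x (D.yReg ε x) ≤ ((D.θ x + (D.h 0 + L * R) : ℝ) : EReal) := by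
    rw [EReal.coe_add]
    refine add_le_add_right (iSup₂_le fun P _ => ?_) _
    have h1 : ‖∫ ξ, D.f x (D.yReg ε x ξ) ξ ∂(P : Measure D.Ξ)‖ ≤ R := by
      simpa using norm_integral_le_of_norm_le_const (μ := (P : Measure D.Ξ))
        (Eventually.of_forall fun ξ => hR x hx ξ)
    have h2 := hL.dist_le_mul (∫ ξ, D.f x (D.yReg ε x ξ) ξ ∂(P : Measure D.Ξ)) 0
    rw [Real.dist_eq, dist_zero_right] at h2
    have h3 := (abs_le.1 h2).2
    have h4 := mul_le_mul_of_nonneg_left h1 L.coe_nonneg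
    exact EReal.coe_le_coe_iff.2 (by linarith)
  have hlb : ((D.θ x + D.h (∫ ξ, D.f x (D.yReg ε x ξ) ξ ∂(P₀ : Measure D.Ξ)) : ℝ) : EReal)
      ≤ D.Φ x (D.yReg ε x) := by
    rw [EReal.coe_add, Φ]
    refine add_le_add_right ?_ _
    exact le_iSup₂_of_le P₀ hP₀ le_rfl
  refine ⟨(D.Φ x (D.yReg ε x)).toReal, (EReal.coe_toReal ?_ ?_).symm⟩
  · exact (hub.trans_lt (EReal.coe_lt_top _)).ne
  · exact ((EReal.bot_lt_coe _).trans_le hlb).ne'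

lemma exists_Φ_yReg_le_add_dist (hD : D.Standing) (hΞ : Bornology.IsBounded D.Ξ)
    (hf : ∃ K, LipschitzWith K fun p : Vec n × Vec m × D.Ξ => D.f p.1 p.2.1 p.2.2)
    (hε : 0 < ε) : ∃ C : ℝ, 0 ≤ C ∧ ∀ x ∈ D.X, ∀ x' ∈ D.X,
      D.Φ x (D.yReg ε x) ≤ D.Φ x' (D.yReg ε x') + ((C * dist x x' : ℝ) : EReal) := by
  obtain ⟨C, hC0, hC⟩ := exists_norm_f_yReg_sub_le hD hΞ hf hε
  obtain ⟨L, hL⟩ := hD.lip_h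
  obtain ⟨T, hT⟩ := hD.lip_θ
  refine ⟨T + L * C, by positivity, fun x hx x' hx' => ?_⟩
  refine coe_add_biSup_le_of_forall_exists fun P hP => ⟨P, hP, ?_⟩
  have h1 := norm_integral_sub_integral_le (integrable_f_yReg hD hΞ hf hε hx P)
    (integrable_f_yReg hD hΞ hf hε hx' P) (c := C * dist x x')
    fun ξ => by simpa using hC x hx x' hx' ξ ξ
  have h2 := hL.dist_le_mul (∫ ξ, D.f x (D.yReg ε x ξ) ξ ∂(P : Measure D.Ξ))
    (∫ ξ, D.f x' (D.yReg ε x' ξ) ξ ∂(P : Measure D.Ξ))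
  rw [Real.dist_eq, dist_eq_norm] at h2
  have h3 := hT.dist_le_mul x x'
  rw [Real.dist_eq] at h3
  have h4 : (L : ℝ) * _ ≤ L * (C * dist x x') := mul_le_mul_of_nonneg_left h1 L.coe_nonneg
  have h5 := (abs_le.1 h2).2
  have h6 := (abs_le.1 h3).2
  linarith

/-- Under uniform convergence of the regularized solutions, `x ↦ Φ(x, ȳ(x, ·))` is real valued and
continuous on `X`. -/
lemma exists_continuousOn_eq_Φ_yLeast (hD : D.Standing) (hΞ : Bornology.IsBounded D.Ξ)
    (hf : ∃ K, LipschitzWith K fun p : Vec n × Vec m × D.Ξ => D.f p.1 p.2.1 p.2.2)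
    (hP : D.ambiguity.Nonempty)
    (h : Tendsto (fun ε => ⨆ x ∈ D.X, ⨆ P ∈ D.ambiguity,
      ∫⁻ ξ, ‖D.yReg ε x ξ - D.yLeast x ξ‖ₑ ^ 2 ∂(P : Measure D.Ξ)) (𝓝[>] 0) (𝓝 0)) :
    ∃ φ : Vec n → ℝ, ContinuousOn φ D.X ∧ ∀ x ∈ D.X, D.Φ x (D.yLeast x) = (φ x : EReal) := by
  have hreal : ∀ x ∈ D.X, D.Φ x (D.yLeast x) = ((D.Φ x (D.yLeast x)).toReal : EReal) := by
    intro x hx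
    obtain ⟨ε, hn, hε⟩ :=
      ((eventually_Φ_yLeast_near hD hΞ hf h one_pos).and self_mem_nhdsWithin).exists
    obtain ⟨c, hc⟩ := exists_coe_eq_Φ_yReg hD hΞ hf hP hε hx
    obtain ⟨h1, h2⟩ := hn x hx
    rw [hc] at h1 h2
    refine (EReal.coe_toReal (fun ht => ?_) (fun hb => ?_)).symm
    · rw [ht, ← EReal.coe_add] at h2
      exact absurd (EReal.coe_lt_top (c + 1)) (not_lt.2 h2)
    · rw [hb, EReal.bot_add] at h1
      exact absurd (EReal.bot_lt_coe c) (not_lt.2 h1)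
  refine ⟨fun x => (D.Φ x (D.yLeast x)).toReal, ?_, hreal⟩
  set φ : Vec n → ℝ := fun x => (D.Φ x (D.yLeast x)).toReal with hφ
  rw [Metric.continuousOn_iff]
  intro x hx e he
  -- Uniform-limit argument: one `ε` brings `φ_ε` within `e / 4` of `φ` on all of `X`, and the
  -- Lipschitz bound for that `φ_ε` pays the remaining `e / 2`.
  obtain ⟨ε, hn, hε⟩ := ((eventually_Φ_yLeast_near hD hΞ hf h (by linarith : 0 < e / 4)).and
    self_mem_nhdsWithin).exists
  obtain ⟨C, hC0, hC⟩ := exists_Φ_yReg_le_add_dist hD hΞ hf hε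
  have key : ∀ w ∈ D.X, ∀ z ∈ D.X, φ w ≤ φ z + C * dist w z + e / 2 := by
    intro w hw z hz
    obtain ⟨a, ha⟩ := exists_coe_eq_Φ_yReg hD hΞ hf hP hε hw
    obtain ⟨b, hb⟩ := exists_coe_eq_Φ_yReg hD hΞ hf hP hε hz
    have h1 := (hn w hw).2
    have h2 := (hn z hz).1
    have h3 := hC w hw z hz
    rw [hreal w hw, ha, ← EReal.coe_add, EReal.coe_le_coe_iff] at h1
    rw [hreal z hz, hb, ← EReal.coe_add, EReal.coe_le_coe_iff] at h2
    rw [ha, hb, ← EReal.coe_add, EReal.coe_le_coe_iff] at h3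
    simp only [hφ]
    linarith
  refine ⟨e / (2 * (C + 1)), by positivity, fun w hw hd => ?_⟩
  rw [lt_div_iff₀ (by positivity)] at hd
  have h1 := key w hw x hx
  have h2 := key x hx w hw
  rw [dist_comm x w] at h2
  have h3 : C * dist w x < e / 2 := by
    have : 0 ≤ dist w x := dist_nonneg
    rcases this.eq_or_lt with h0 | h0
    · rw [← h0]; linarith
    · nlinarith
  rw [Real.dist_eq, abs_lt]
  constructor <;> linarith

/-- By `hopt`, restricting to least-norm selections loses nothing, so such an `x` paired with `ȳ(x,
·)` attains `v*`. -/
lemma argmin_Φ_yLeast_subset_solX (hD : D.Standing) (hΞ : Bornology.IsBounded D.Ξ)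
    (hopt : D.optVal = ⨅ x ∈ D.X, D.Φ x (D.yLeast x)) :
    {x | x ∈ D.X ∧ ∀ x' ∈ D.X, D.Φ x (D.yLeast x) ≤ D.Φ x' (D.yLeast x')} ⊆ D.solX := by
  rintro x ⟨hx, hmin⟩
  refine ⟨(x, D.yLeast x), ⟨yLeast_feasible hD hΞ hx, fun z hz => ?_⟩, rfl⟩
  have h1 : D.Φ x (D.yLeast x) ≤ D.optVal := hopt ▸ le_iInf₂ hmin
  exact h1.trans (iInf₂_le z hz)

lemma tendsto_limsup_deviation (hD : D.Standing) (hΞ : Bornology.IsBounded D.Ξ)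
    (hf : ∃ K, LipschitzWith K fun p : Vec n × Vec m × D.Ξ => D.f p.1 p.2.1 p.2.2)
    [FiniteDimensional ℝ V] (hSlater : D.Slater) (hΨ : ∃ K, LipschitzWith K D.Ψ)
    {s : (k : ℕ) → Fin k → D.Ξ} (hs : Tendsto (fun k => D.fillDist (s k)) atTop (𝓝 0))
    (h : Tendsto (fun ε => ⨆ x ∈ D.X, ⨆ P ∈ D.ambiguity,
      ∫⁻ ξ, ‖D.yReg ε x ξ - D.yLeast x ξ‖ₑ ^ 2 ∂(P : Measure D.Ξ)) (𝓝[>] 0) (𝓝 0))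
    (hopt : D.optVal = ⨅ x ∈ D.X, D.Φ x (D.yLeast x)) :
    Tendsto (fun ε => limsup (fun k => deviation (D.solXRegDisc (s k) ε) D.solX) atTop)
      (𝓝[>] 0) (𝓝 0) := by
  have hP : D.ambiguity.Nonempty := by
    obtain ⟨P₀, α, hα, hP₀, hball⟩ := hSlater
    -- The zero perturbation shows that `P₀` itself lies in `𝒫`.
    exact ⟨P₀, hP₀, by simpa using hball 0 (by simpa using hα.le)⟩
  obtain ⟨φ, hφc, hφ⟩ := exists_continuousOn_eq_Φ_yLeast hD hΞ hf hP h
  rw [ENNReal.tendsto_nhds_zero]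
  intro δ hδ
  rcases D.X.eq_empty_or_nonempty with he | hne
  · refine Eventually.of_forall fun ε => ?_
    simp [deviation, solXRegDisc, he]
  obtain ⟨z, hz, hzmin⟩ := hD.compact_X.exists_isMinOn hne hφc
  obtain ⟨η, hη, hηδ⟩ := hD.compact_X.exists_forall_infEDist_le hφc (fun x hx => hzmin hx) hδ
  have hsub : {w | w ∈ D.X ∧ ∀ x ∈ D.X, φ w ≤ φ x} ⊆ D.solX := by
    refine subset_trans ?_ (argmin_Φ_yLeast_subset_solX hD hΞ hopt)
    rintro w ⟨hw, hwm⟩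
    refine ⟨hw, fun x hx => ?_⟩
    rw [hφ w hw, hφ x hx]
    exact EReal.coe_le_coe_iff.2 (hwm x hx)
  have hη3 : 0 < η / 3 := by positivity
  filter_upwards [self_mem_nhdsWithin, eventually_Φ_yLeast_near hD hΞ hf h hη3] with ε hε hn
  refine limsup_le_of_le (h := ?_)
  filter_upwards [eventually_le_ΦRegDisc_add hD hΞ hf hSlater hΨ hs hε hη3] with k hk
  refine iSup₂_le fun x hx => (Metric.infEDist_anti hsub).trans (hηδ x hx.1 ?_)
  -- One third each for regularization at `x`, discretization at `x` and regularization at `z`;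
  -- discretization at `z` costs nothing, since it only lowers the objective.
  have h1 : D.Φ x (D.yLeast x) ≤ D.Φ z (D.yLeast z) + ((η / 3 : ℝ) : EReal)
      + ((η / 3 : ℝ) : EReal) + ((η / 3 : ℝ) : EReal) :=
    calc D.Φ x (D.yLeast x) ≤ D.Φ x (D.yReg ε x) + ((η / 3 : ℝ) : EReal) := (hn x hx.1).2
      _ ≤ D.ΦRegDisc (s k) ε x + ((η / 3 : ℝ) : EReal) + ((η / 3 : ℝ) : EReal) := by
        gcongr; exact hk x hx.1
      _ ≤ D.Φ z (D.yReg ε z) + ((η / 3 : ℝ) : EReal) + ((η / 3 : ℝ) : EReal) := by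
        gcongr; exact (hx.2 z hz).trans (ΦRegDisc_le hΞ hΨ (s k) ε z)
      _ ≤ _ := by gcongr; exact (hn z hz).1
  rw [hφ x hx.1, hφ z hz, ← EReal.coe_add, ← EReal.coe_add, ← EReal.coe_add,
    EReal.coe_le_coe_iff] at h1
  linarith

end DRMPSCC

theorem theorem6 {n m l ν : ℕ} {V : Type*} [NormedAddCommGroup V] [NormedSpace ℝ V]
    [FiniteDimensional ℝ V] (D : DRMPSCC n m l ν V) (hD : D.Standing)
    -- the support set is bounded, `f` is jointly Lipschitz continuous
    (hΞ : Bornology.IsBounded D.Ξ)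
    (hf : ∃ K, LipschitzWith K fun p : Vec n × Vec m × D.Ξ => D.f p.1 p.2.1 p.2.2)
    -- Slater condition, Lipschitz moment mapping, and samples filling the support set
    (hSlater : D.Slater) (hΨ : ∃ K, LipschitzWith K D.Ψ)
    (s : (k : ℕ) → Fin k → D.Ξ) (hs : Tendsto (fun k => D.fillDist (s k)) atTop (𝓝 0))
    -- the auxiliary problems with radii `r ε ↓ 0` have optimal values tending to `v*`
    (r : ℝ → ℝ) (hr_pos : ∀ ε, 0 < ε → 0 < r ε) (hr : Tendsto r (𝓝[>] 0) (𝓝 0))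
    (haux : Tendsto (fun ε => D.auxVal ε (r ε)) (𝓝[>] 0) (𝓝 D.optVal)) :
    (∃ u : ℝ → EReal,
      (∀ ε, 0 < ε → Tendsto (fun k => D.optValRegDisc (s k) ε) atTop (𝓝 (u ε))) ∧
      Tendsto u (𝓝[>] 0) (𝓝 D.optVal)) ∧
    (Tendsto (fun ε => ⨆ x ∈ D.X, ⨆ P ∈ D.ambiguity,
        ∫⁻ ξ, ‖D.yReg ε x ξ - D.yLeast x ξ‖ₑ ^ 2 ∂(P : Measure D.Ξ)) (𝓝[>] 0) (𝓝 0) →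
      D.optVal = ⨅ x ∈ D.X, D.Φ x (D.yLeast x) →
      Tendsto (fun ε => limsup (fun k => deviation (D.solXRegDisc (s k) ε) D.solX) atTop)
        (𝓝[>] 0) (𝓝 0)) := by
  refine ⟨⟨fun ε => ⨅ x ∈ D.X, D.Φ x (D.yReg ε x), fun ε hε => ?_, ?_⟩, fun h hopt => ?_⟩
  · exact DRMPSCC.tendsto_optValRegDisc hD hΞ hf hSlater hΨ hs hε
  · exact DRMPSCC.tendsto_iInf_Φ_yReg hD hΞ hf hr_pos hr haux
  · exact DRMPSCC.tendsto_limsup_deviation hD hΞ hf hSlater hΨ hs h hopt
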